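/- Let $K$ be a field, let $n, k \ge 0$ be integers, and let $\varepsilon : \{1,\dots,n-1\} \to \{\mathrm{u},\mathrm{o}\}$ be arbitrary. Let $A_n^\varepsilon$ be the quiver with vertices $1,\dots,n$, with an arrow $a_i : i \to i+1$ if $\varepsilon(i)=\mathrm{o}$ and an arrow $a_i^* : i+1 \to i$ if $\varepsilon(i)=\mathrm{u}$. Let $KA_n^\varepsilon$ be its path algebra, with paths composed from left to right, and consider finitely generated left $KA_n^\varepsilon$-modules up to isomorphism. Thus a module $X$ consists of finite-dimensional vector spaces $X(1),\dots,X(n)$, a linear map $X(a_i) : X(i+1) \to X(i)$ for each $i$ with $\varepsilon(i)=\mathrm{o}$, and a linear map $X(a_i^*) : X(i) \to X(i+1)$ for each $i$ with $\varepsilon(i)=\mathrm{u}$. Put $X(a_i)=0$ if $\varepsilon(i)=\mathrm{u}$. A brick is a module whose endomorphism algebra is a division algebra. Let $\mathrm{weak}(KA_n^\varepsilon,k)$ be the set of weak exceptional sequences of length $k$, that is, of sequences $(X_k,\dots,X_1)$ of modules such that $\mathrm{End}(X_i) \cong K$ for all $i$, $\mathrm{Hom}(X_i,X_j)=0$ for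 $i<j$, and $\mathrm{Ext}^1(X_i,X_j)=0$ for $i\le j$. An arc $\gamma$ on the nodes $0,1,\dots,n$ (placed at the points $(i,0)$ of the plane) consists of two nodes $\ell(\gamma)<r(\gamma)$ and a continuous function $\gamma : [\ell(\gamma),r(\gamma)] \to \mathbb{R}$ which is $0$ at $\ell(\gamma)$ and $r(\gamma)$ and nonzero at each node $m$ with $\ell(\gamma)<m<r(\gamma)$; it passes above $m$ if $\gamma(m)>0$ and below $m$ if $\gamma(m)<0$. Arcs are considered up to combinatorial equivalence: two arcs are equivalent if they have the same endpoints and pass on the same side of each node strictly between them. An arc is $\varepsilon$-admissible if, for each node $m$ strictly between its endpoints, it passes above $m$ if $\varepsilon(m)=\mathrm{o}$ and below $m$ if $\varepsilon(m)=\mathrm{u}$. A shared endpoint of two arcs is a node that is the left endpoint of both or the right endpoint of both; a contested endpoint is a node that is the right endpoint of one and the left endpoint of the other; a nontrivial crossing of two representatives is a common point, over the intersection of their closed intervals of definition, that is neither a shared nor a contested endpoint. If two arcs with a shared endpoint have representatives without a nontrivial crossing, then $\gamma'$ is called clockwise from $\gamma$ if, for such representatives, close to each shared left endpoint $\gamma'$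 runs below $\gamma$, and close to each shared right endpoint $\gamma'$ runs above $\gamma$. Let $\mathrm{arc}_\varepsilon(n,k)$ be the set of $\varepsilon$-admissible labeled strand diagrams of length $k$, that is, of sequences $(\gamma_k,\dots,\gamma_1)$ of $\varepsilon$-admissible arcs such that for all $1\le i<j\le k$: 1. $\gamma_i$ and $\gamma_j$ have representatives without a nontrivial crossing; 2. if $\gamma_i$ and $\gamma_j$ have a shared endpoint, then $\gamma_j$ is clockwise from $\gamma_i$; 3. if $x$ is a contested endpoint of $\gamma_i$ and $\gamma_j$, then $x=r(\gamma_i)$ if $\varepsilon(x)=\mathrm{o}$, and $x=r(\gamma_j)$ if $\varepsilon(x)=\mathrm{u}$. For a brick $X$, let $i$ and $j$ be the smallest and the largest vertex at which $X$ is nonzero, and let $\sigma(X)$ be the arc with left endpoint $i-1$ and right endpoint $j$ which passes above a node $m$ with $i\le m<j$ if $X(a_m)\ne 0$ and below $m$ otherwise. Then $\sigma$, applied to each term of a sequence, induces a bijection $$\mathrm{weak}(KA_n^\varepsilon,k) \longrightarrow \mathrm{arc}_\varepsilon(n,k).$$ -/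

import Mathlib

open CategoryTheory

universe u

namespace StrandModel

/-! ### Orientations, the quiver and its representations -/

/-- The two letters `u` (under) and `o` (over). -/
inductive Side
  | under
  | over

/-- The vertices `1, …, n` of the quiver of type `A_n` with orientation `ε`.  Only the values of `ε`
at `1, …, n - 1` are ever used. -/
@[ext]
structure Vertex (n : ℕ) (ε : ℕ → Side) where
  idx : ℕ
  one_le : 1 ≤ idx
  le_n : idx ≤ n

/-- The arrows of the quiver: `a_i : i → i + 1` when `ε i = o`, and `a_i^* : i + 1 → i`
when `ε i = u`. -/
inductive Arrow (n : ℕ) (ε : ℕ → Side) : Vertex n ε → Vertex n ε → Type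
  | a (i j : Vertex n ε) (h : j.idx = i.idx + 1) (hε : ε i.idx = Side.over) : Arrow n ε i j
  | aStar (i j : Vertex n ε) (h : j.idx = i.idx + 1) (hε : ε i.idx = Side.under) : Arrow n ε j i

instance (n : ℕ) (ε : ℕ → Side) : Quiver (Vertex n ε) where
  Hom := Arrow n ε

/-- The category of left modules over the path algebra of the quiver, paths being composed from left
to right.  For such a module `X`, an arrow `a : s → t` acts as a linear map `X t → X s`, where `X s`
is the image of the idempotent of `s`; so a module is a `K`-linear representation of the opposite
quiver, that is, a functor on the free category of the opposite quiver. -/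
abbrev Rep (K : Type u) [Field K] (n : ℕ) (ε : ℕ → Side) : Type (u + 1) :=
  Paths (Vertex n ε)ᵒᵖ ⥤ ModuleCat.{u} K

section Rep

variable {K : Type u} [Field K] {n : ℕ} {ε : ℕ → Side}

/-- The vector space of a representation at a vertex. -/
abbrev Rep.space (X : Rep K n ε) (i : Vertex n ε) : ModuleCat.{u} K :=
  X.obj ((Paths.of (Vertex n ε)ᵒᵖ).obj (Opposite.op i))

/-- The linear map `X t → X s` by which an arrow `s → t` acts. -/
abbrev Rep.act (X : Rep K n ε) {s t : Vertex n ε} (a : s ⟶ t) : X.space t ⟶ X.space s :=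
  X.map ((Paths.of (Vertex n ε)ᵒᵖ).map a.op)

/-- Finitely generated modules over the path algebra: finite-dimensional representations. -/
def Rep.IsFinite (X : Rep K n ε) : Prop :=
  ∀ i : Vertex n ε, FiniteDimensional K (X.space i)

/-- `Ext¹(X, Y) = 0`. -/
def ExtOneVanishes (X Y : Rep K n ε) : Prop :=
  letI := HasExt.standard (Rep K n ε)
  Subsingleton (Abelian.Ext.{u + 1} X Y 1)

/-- A brick: a finitely generated module whose endomorphism algebra is a division algebra. -/
structure Rep.IsBrick (X : Rep K n ε) : Prop where
  finite : X.IsFinite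
  id_ne_zero : 𝟙 X ≠ 0
  isIso_of_ne_zero : ∀ f : X ⟶ X, f ≠ 0 → IsIso f

/-- Weak exceptional sequences `(X_k, …, X_1)`; the index `i : Fin k` stands for `i + 1`.
The modules are automatically indecomposable, as their endomorphism algebras are `K`. -/
structure IsWeakExceptional {k : ℕ} (X : Fin k → Rep K n ε) : Prop where
  finite : ∀ i, (X i).IsFinite
  end_eq : ∀ i, Nonempty (End (X i) ≃ₐ[K] K)
  hom_eq_zero : ∀ i j, i < j → ∀ f : X i ⟶ X j, f = 0
  ext_eq_zero : ∀ i j, i ≤ j → ExtOneVanishes (X i) (X j)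

end Rep

/-- The bricks, before passing to isomorphism classes. -/
abbrev BrickRep (K : Type u) [Field K] (n : ℕ) (ε : ℕ → Side) : Type (u + 1) :=
  {X : Rep K n ε // X.IsBrick}

/-- Isomorphism of bricks. -/
instance brickSetoid (K : Type u) [Field K] (n : ℕ) (ε : ℕ → Side) :
    Setoid (BrickRep K n ε) where
  r X Y := Nonempty (X.1 ≅ Y.1)
  iseqv :=
    { refl := fun X => ⟨Iso.refl X.1⟩
      symm := fun ⟨e⟩ => ⟨e.symm⟩
      trans := fun ⟨e⟩ ⟨f⟩ => ⟨e.trans f⟩ }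

/-- `brick(KA_n^ε)`: the isomorphism classes of bricks. -/
def Brick (K : Type u) [Field K] (n : ℕ) (ε : ℕ → Side) : Type (u + 1) :=
  Quotient (brickSetoid K n ε)

/-- `weak(KA_n^ε, k)`: the weak exceptional sequences of length `k`, up to isomorphism. -/
def weakExceptional (K : Type u) [Field K] (n : ℕ) (ε : ℕ → Side) (k : ℕ) :
    Set (Fin k → Brick K n ε) :=
  {Δ | ∃ X : Fin k → BrickRep K n ε,
    (∀ i, Quotient.mk (brickSetoid K n ε) (X i) = Δ i) ∧ IsWeakExceptional fun i => (X i).1}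

/-! ### Arcs -/

/-- A combinatorial equivalence class of arcs on the nodes `0, …, n`: the two endpoints and the set
of those nodes strictly between them that the arc passes above; it passes below the other nodes
strictly between its endpoints. -/
@[ext]
structure ArcClass (n : ℕ) where
  left : ℕ
  right : ℕ
  above : Finset ℕ
  left_lt_right : left < right
  right_le : right ≤ n
  above_subset : above ⊆ Finset.Ioo left right

/-- `f` is a representative of `γ`: an arc, that is, a continuous function on
`[left, right]` which vanishes at the endpoints and at no integer strictly between them, which is
positive at exactly those integers strictly between the endpoints that `γ` passes above.
The values of `f` outside `[left, right]` are irrelevant. -/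
structure ArcClass.IsRep {n : ℕ} (γ : ArcClass n) (f : ℝ → ℝ) : Prop where
  continuousOn : ContinuousOn f (Set.Icc (γ.left : ℝ) (γ.right : ℝ))
  map_left : f γ.left = 0
  map_right : f γ.right = 0
  pos_of_mem : ∀ m ∈ Finset.Ioo γ.left γ.right, m ∈ γ.above → 0 < f m
  neg_of_notMem : ∀ m ∈ Finset.Ioo γ.left γ.right, m ∉ γ.above → f m < 0

section Arcs

variable {n : ℕ}

/-- The node `x` is a shared left endpoint, or a shared right endpoint. -/
def ArcClass.SharedEndpoint (γ₁ γ₂ : ArcClass n) (x : ℕ) : Prop :=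
  (γ₁.left = x ∧ γ₂.left = x) ∨ (γ₁.right = x ∧ γ₂.right = x)

/-- The node `x` is a contested endpoint. -/
def ArcClass.ContestedEndpoint (γ₁ γ₂ : ArcClass n) (x : ℕ) : Prop :=
  (γ₁.right = x ∧ γ₂.left = x) ∨ (γ₁.left = x ∧ γ₂.right = x)

/-- `f₁` and `f₂` are representatives of `γ₁` and `γ₂` without a nontrivial crossing: in the common
closed support, they meet at shared and contested endpoints only. -/
structure ArcClass.Uncrossed (γ₁ γ₂ : ArcClass n) (f₁ f₂ : ℝ → ℝ) : Prop where
  rep₁ : γ₁.IsRep f₁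
  rep₂ : γ₂.IsRep f₂
  meet : ∀ x : ℝ, x ∈ Set.Icc (γ₁.left : ℝ) γ₁.right → x ∈ Set.Icc (γ₂.left : ℝ) γ₂.right →
    f₁ x = f₂ x →
      ∃ m : ℕ, (m : ℝ) = x ∧ (γ₁.SharedEndpoint γ₂ m ∨ γ₁.ContestedEndpoint γ₂ m)

/-- `γ₂` is clockwise of `γ₁` (for arcs with a shared endpoint and without a nontrivial crossing):
the shared endpoint is directed from `γ₂` to `γ₁` as a Hom-crossing.  That is, close to a
shared left endpoint `γ₂` is below `γ₁`, and close to a shared right endpoint it is above. -/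
def ArcClass.Clockwise (γ₂ γ₁ : ArcClass n) : Prop :=
  ∃ f₁ f₂ : ℝ → ℝ, γ₁.Uncrossed γ₂ f₁ f₂ ∧
    (γ₁.left = γ₂.left → ∀ η : ℝ, 0 < η → ∃ δ : ℝ, 0 < δ ∧ δ < η ∧
      f₂ (γ₁.left + δ) < f₁ (γ₁.left + δ)) ∧
    (γ₁.right = γ₂.right → ∀ η : ℝ, 0 < η → ∃ δ : ℝ, 0 < δ ∧ δ < η ∧
      f₁ (γ₁.right - δ) < f₂ (γ₁.right - δ))

/-- `γ` is `ε`-admissible: it passes above `m` if `ε m = o` and below `m` if `ε m = u`, for each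
node `m` strictly between its endpoints. -/
def ArcClass.Admissible (ε : ℕ → Side) (γ : ArcClass n) : Prop :=
  ∀ m ∈ Finset.Ioo γ.left γ.right, m ∈ γ.above ↔ ε m = Side.over

end Arcs

/-- `arc_ε(n, k)`: the `ε`-admissible labeled strand diagrams `(γ_k, …, γ_1)`; the index `i : Fin k`
stands for `i + 1`. -/
def strandDiagrams (n : ℕ) (ε : ℕ → Side) (k : ℕ) : Set (Fin k → ArcClass n) :=
  {γ | (∀ i, (γ i).Admissible ε) ∧
    ∀ i j, i < j →
      (∃ f g : ℝ → ℝ, (γ i).Uncrossed (γ j) f g) ∧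
      ((∃ x, (γ i).SharedEndpoint (γ j) x) → (γ j).Clockwise (γ i)) ∧
      (∀ x, (γ i).ContestedEndpoint (γ j) x →
        (ε x = Side.over → x = (γ i).right) ∧ (ε x = Side.under → x = (γ j).right))}

/-! ### The map from bricks to arcs -/

section Sigma

variable {K : Type u} [Field K] {n : ℕ} {ε : ℕ → Side}

/-- The vertices at which a representation is nonzero. -/
noncomputable def Rep.support (X : Rep K n ε) : Finset ℕ :=
  open Classical in
  (Finset.Icc 1 n).filter fun m => ∃ i : Vertex n ε, i.idx = m ∧ Nontrivial (X.space i)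

theorem Rep.mem_support {X : Rep K n ε} {m : ℕ} :
    m ∈ X.support ↔ m ∈ Finset.Icc 1 n ∧ ∃ i : Vertex n ε, i.idx = m ∧ Nontrivial (X.space i) := by
  classical
  simp only [Rep.support, Finset.mem_filter]

/-- `X(a_m) ≠ 0`; this includes that `a_m` is an arrow of the quiver, that is, `ε m = o`. -/
def Rep.MapNeZero (X : Rep K n ε) (m : ℕ) : Prop :=
  ∃ (i j : Vertex n ε) (h : j.idx = i.idx + 1) (hε : ε i.idx = Side.over),
    i.idx = m ∧ X.act (s := i) (t := j) (Arrow.a i j h hε) ≠ 0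

theorem Rep.IsBrick.support_nonempty {X : Rep K n ε} (hX : X.IsBrick) : X.support.Nonempty := by
  classical
  by_contra hne
  rw [Finset.not_nonempty_iff_eq_empty] at hne
  apply hX.id_ne_zero
  ext p x
  let i : Vertex n ε := Opposite.unop (show (Vertex n ε)ᵒᵖ from p)
  have hsub : Subsingleton (X.space i) := by
    by_contra hs
    have hmem : i.idx ∈ X.support := by
      exact Rep.mem_support.2 ⟨Finset.mem_Icc.2 ⟨i.one_le, i.le_n⟩, i, rfl,
        not_subsingleton_iff_nontrivial.mp hs⟩
    rw [hne] at hmem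
    simp at hmem
  exact hsub.elim _ _

theorem Rep.support_eq_of_iso {X Y : Rep K n ε} (e : X ≅ Y) : X.support = Y.support := by
  classical
  unfold Rep.support
  apply Finset.filter_congr
  intro m _
  refine exists_congr fun i => and_congr_right fun _ => ?_
  exact (e.app _).toLinearEquiv.toEquiv.nontrivial_congr

theorem Rep.MapNeZero.of_iso {X Y : Rep K n ε} (e : X ≅ Y) {m : ℕ} (h : X.MapNeZero m) :
    Y.MapNeZero m := by
  obtain ⟨i, j, hij, hε, him, hne⟩ := h
  refine ⟨i, j, hij, hε, him, fun h0 => hne ?_⟩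
  have hnat := e.hom.naturality
    ((Paths.of (Vertex n ε)ᵒᵖ).map (Quiver.Hom.op (Arrow.a i j hij hε : i ⟶ j)))
  have h0' : Y.map ((Paths.of (Vertex n ε)ᵒᵖ).map
      (Quiver.Hom.op (Arrow.a i j hij hε : i ⟶ j))) = 0 := h0
  rw [h0', Limits.comp_zero] at hnat
  exact (cancel_mono (e.hom.app _)).1 (hnat.trans Limits.zero_comp.symm)

/-- The arc of a brick `X`.  If the first and last vertices of the support of `X` are `i` and `j`,
then the endpoints are `i - 1` and `j`, and the arc passes above a node `m` strictly between
them if `X(a_m) ≠ 0`, and below `m` otherwise. -/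
noncomputable def arcOfBrick (X : BrickRep K n ε) : ArcClass n where
  left := X.1.support.min' X.2.support_nonempty - 1
  right := X.1.support.max' X.2.support_nonempty
  above :=
    open Classical in
    (Finset.Ioo (X.1.support.min' X.2.support_nonempty - 1)
      (X.1.support.max' X.2.support_nonempty)).filter fun m => X.1.MapNeZero m
  left_lt_right := by
    have h1 : 1 ≤ X.1.support.min' X.2.support_nonempty :=
      (Finset.mem_Icc.1 (Rep.mem_support.1 (Finset.min'_mem _ X.2.support_nonempty)).1).1
    have h2 := Finset.min'_le_max' X.1.support X.2.support_nonempty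
    omega
  right_le :=
    (Finset.mem_Icc.1 (Rep.mem_support.1 (Finset.max'_mem _ X.2.support_nonempty)).1).2
  above_subset := by
    classical exact Finset.filter_subset _ _

theorem arcOfBrick_eq_of_iso {X Y : BrickRep K n ε} (e : X.1 ≅ Y.1) :
    arcOfBrick X = arcOfBrick Y := by
  classical
  have hs := Rep.support_eq_of_iso e
  have hm : X.1.MapNeZero = Y.1.MapNeZero :=
    funext fun m => propext ⟨Rep.MapNeZero.of_iso e, Rep.MapNeZero.of_iso e.symm⟩
  ext1 <;> simp only [arcOfBrick, hs, hm]

/-- The map `σ` from isomorphism classes of bricks to arcs. -/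
noncomputable def sigma : Brick K n ε → ArcClass n :=
  Quotient.lift arcOfBrick fun _ _ ⟨e⟩ => arcOfBrick_eq_of_iso e

end Sigma

end StrandModel

/-!
The argument has a representation-theoretic half, which turns bricks into intervals and vanishing of
`Hom` and `Ext¹` into inequalities, and a topological half, which turns crossings of arcs into the
same inequalities.

*Bricks are interval modules* (`Rep.IsBrick.exists_intervalBasis`). Going along the quiver from left
to right, one keeps the invariant that every nonzero vector, and every nonzero functional, at the
current vertex belongs to an interval module that is a retract of the part seen so far
(`LeftGeneric`). The invariant passes over an arrow acting rightwards by an injection or leftwards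
by a surjection. At the first arrow that is neither, or at the last vertex, a retract of the part
seen so far is a retract of the whole module; its idempotent is a nonzero endomorphism, so for a
brick it is the identity. Hence `σ` is injective, and admissible arcs are exactly the arcs of
interval modules.

*`Hom` and `Ext¹`.* For a quiver, `Ext¹(X, Y)` is the cokernel of
`⨁ᵥ Hom(Xᵥ, Yᵥ) ⟶ ⨁ₐ Hom(X_t, Y_s)`, the kernel being `Hom(X, Y)`; only the vanishing of `Ext¹` is
needed (`ExtOneVanishes.of_cochain`, `ExtOneVanishes.exists_cochain`). For two interval modules
with arcs `γ` and `γ'` the map is given by scalars on the vertices of the common interval and by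
differences along the arrows. Inside the common interval all differences occur; at its left end
there is one more equation precisely if `γ` is below `γ'` there (`BelowLeft`), at its right end
precisely if `γ` is above `γ'` there (`AboveRight`). Both extra equations obstruct solvability, so
`Ext¹ ≠ 0`; none leaves the constants, so `Hom ≠ 0`; with exactly one both vanish. For disjoint
intervals only a contested endpoint can contribute.

*Arcs.* Having exactly one of `BelowLeft` and `AboveRight` means that one arc is strictly above the
other throughout the common interval, except at shared endpoints. Piecewise linear functions
realize this, and the intermediate value theorem gives the converse
(`ArcClass.uncrossed_and_clockwise_iff`).
-/

namespace StrandModel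

/-! ### Morphisms and representations from vertexwise data -/

section

variable {K : Type u} [Field K] {n : ℕ} {ε : ℕ → Side}

/-- The representation with given spaces and given actions of the arrows. -/
def repMk (V : Vertex n ε → ModuleCat.{u} K) (m : ∀ ⦃s t : Vertex n ε⦄, (s ⟶ t) → (V t ⟶ V s)) :
    Rep K n ε :=
  Paths.lift { obj := fun v => V v.unop, map := fun f => m f.unop }

theorem repMk_act (V : Vertex n ε → ModuleCat.{u} K)
    (m : ∀ ⦃s t : Vertex n ε⦄, (s ⟶ t) → (V t ⟶ V s)) {s t : Vertex n ε} (a : s ⟶ t) :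
    (repMk V m).act a = m a :=
  Paths.lift_toPath _ _

/-- The morphism of representations with given components. -/
def homMk {X Y : Rep K n ε} (f : ∀ v : Vertex n ε, X.space v →ₗ[K] Y.space v)
    (h : ∀ ⦃s t : Vertex n ε⦄ (a : s ⟶ t) (x : X.space t),
      f s (X.act a x) = Y.act a (f t x)) : X ⟶ Y where
  app p := ModuleCat.ofHom (f (Opposite.unop (show (Vertex n ε)ᵒᵖ from p)))
  naturality p q g := by
    induction g using Paths.induction with
    | id => simp
    | comp p q ih =>
      rw [Functor.map_comp, Functor.map_comp, Category.assoc]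
      have : X.map ((Paths.of (Vertex n ε)ᵒᵖ).map q) ≫ ModuleCat.ofHom (f (Opposite.unop _)) =
          ModuleCat.ofHom (f (Opposite.unop _)) ≫ Y.map ((Paths.of (Vertex n ε)ᵒᵖ).map q) := by
        ext x
        exact h q.unop x
      erw [this, ← Category.assoc, ih, Category.assoc]

/-- The component of a morphism of representations at a vertex. -/
abbrev Rep.homAt {X Y : Rep K n ε} (f : X ⟶ Y) (v : Vertex n ε) : X.space v ⟶ Y.space v :=
  f.app ((Paths.of (Vertex n ε)ᵒᵖ).obj (Opposite.op v))

theorem Rep.homAt_act {X Y : Rep K n ε} (f : X ⟶ Y) {s t : Vertex n ε} (a : s ⟶ t) (x : X.space t) :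
    Rep.homAt f s (X.act a x) = Y.act a (Rep.homAt f t x) :=
  NatTrans.naturality_apply f _ x

theorem Rep.hom_ext {X Y : Rep K n ε} {f g : X ⟶ Y}
    (h : ∀ (v : Vertex n ε) (x : X.space v), Rep.homAt f v x = Rep.homAt g v x) : f = g := by
  ext p x
  exact h (Opposite.unop (show (Vertex n ε)ᵒᵖ from p)) x

end

/-! ### Extensions -/

section

open Limits

variable {K : Type u} [Field K] {n : ℕ} {ε : ℕ → Side}

theorem Rep.projective_evaluationLeftAdjoint (p : Paths (Vertex n ε)ᵒᵖ) (V : ModuleCat.{u} K) :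
    Projective ((evaluationLeftAdjoint (ModuleCat.{u} K) p).obj V) :=
  (evaluationAdjunctionRight (ModuleCat.{u} K) p).map_projective V
    (IsProjective.iff_projective (R := K) V |>.1
      (Module.Projective.of_basis (Module.Basis.ofVectorSpace K V)))

/-- The left adjoints of the evaluations provide the projectives. -/
instance : EnoughProjectives (Rep K n ε) where
  presentation X := by
    let G (p : Paths (Vertex n ε)ᵒᵖ) : Rep K n ε :=
      (evaluationLeftAdjoint (ModuleCat.{u} K) p).obj (X.obj p)
    let c (p : Paths (Vertex n ε)ᵒᵖ) : G p ⟶ X :=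
      ((evaluationAdjunctionRight (ModuleCat.{u} K) p).homEquiv _ _).symm (𝟙 _)
    have hG (p) : Projective (G p) := Rep.projective_evaluationLeftAdjoint p (X.obj p)
    have hp : Projective (∐ G) :=
      ⟨fun f g _ => ⟨Sigma.desc fun p => Projective.factorThru (Sigma.ι G p ≫ f) g,
        Sigma.hom_ext _ _ fun p => by simp⟩⟩
    refine ⟨{ p := ∐ G, f := Sigma.desc c, projective := hp, epi := ?_ }⟩
    rw [NatTrans.epi_iff_epi_app]
    intro p
    have h1 : (evaluationAdjunctionRight (ModuleCat.{u} K) p).homEquiv _ _ (Sigma.ι G p) ≫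
        (Sigma.desc c).app p = 𝟙 (X.obj p) := by
      have := (evaluationAdjunctionRight (ModuleCat.{u} K) p).homEquiv_naturality_right
        (Sigma.ι G p) (Sigma.desc c)
      rw [evaluation_obj_map] at this
      rw [← this, colimit.ι_desc]
      exact Equiv.apply_symm_apply _ _
    exact (SplitEpi.mk _ h1).epi

/-- A short exact sequence of representations is exact at each vertex. -/
theorem Rep.shortExact_homAt {S : ShortComplex (Rep K n ε)} (hS : S.ShortExact) (v : Vertex n ε) :
    Function.Injective (Rep.homAt S.f v) ∧ Function.Surjective (Rep.homAt S.g v) ∧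
      ∀ x, Rep.homAt S.g v x = 0 → ∃ y, Rep.homAt S.f v y = x := by
  have := hS.map_of_exact ((evaluation _ (ModuleCat.{u} K)).obj
    ((Paths.of (Vertex n ε)ᵒᵖ).obj (Opposite.op v)))
  exact ⟨this.moduleCat_injective_f, this.moduleCat_surjective_g,
    (ShortComplex.moduleCat_exact_iff _).1 this.exact⟩

/-- If every family `φ` of linear maps indexed by the arrows is a coboundary, then `Ext¹(X, Y) = 0`.
With `g : P ⟶ X` an epimorphism from a projective and `R` its kernel, a class in `Ext¹(X, Y)` comes
from a morphism `φ : R ⟶ Y`, and it vanishes if `φ` extends to `P`. Vertexwise retractions `ρ` of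
`R ⟶ P` fail to be natural by a family of maps `X_t → R_s`; a family `h` with the image of this
family under `φ` as coboundary corrects `φ ∘ ρ` to the natural extension `φ ∘ ρ + h ∘ g`. -/
theorem ExtOneVanishes.of_cochain {X Y : Rep K n ε}
    (H : ∀ φ : ∀ ⦃s t : Vertex n ε⦄, (s ⟶ t) → (X.space t →ₗ[K] Y.space s),
      ∃ h : ∀ v : Vertex n ε, X.space v →ₗ[K] Y.space v,
        ∀ ⦃s t : Vertex n ε⦄ (a : s ⟶ t) (x : X.space t),
          φ a x = Y.act a (h t x) - h s (X.act a x)) : ExtOneVanishes X Y := by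
  let := HasExt.standard (Rep K n ε)
  refine subsingleton_of_forall_eq (α := Abelian.Ext.{u + 1} X Y 1) 0 fun e => ?_
  let S : ShortComplex (Rep K n ε) :=
    ShortComplex.mk (kernel.ι (Projective.π X)) (Projective.π X) (kernel.condition _)
  have hS : S.ShortExact :=
    { exact := ShortComplex.exact_of_f_is_kernel _ (kernelIsKernel _)
      mono_f := inferInstanceAs (Mono (kernel.ι _))
      epi_g := inferInstanceAs (Epi (Projective.π X)) }
  have : Projective S.X₂ := inferInstanceAs (Projective (Projective.over X))
  obtain ⟨x₁, hx₁⟩ := Abelian.Ext.contravariant_sequence_exact₃ hS Y e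
    (Abelian.Ext.eq_zero_of_projective _) (add_zero 1)
  obtain ⟨φ, rfl⟩ := Abelian.Ext.addEquiv₀.symm.surjective x₁
  suffices hψ : ∃ ψ : S.X₂ ⟶ Y, S.f ≫ ψ = φ by
    obtain ⟨ψ, rfl⟩ := hψ
    rw [← hx₁]
    simp [← Abelian.Ext.mk₀_comp_mk₀]
  choose ρ hρ using fun v => LinearMap.exists_leftInverse_of_injective (Rep.homAt S.f v).hom
    (LinearMap.ker_eq_bot.2 (Rep.shortExact_homAt hS v).1)
  choose σ hσ using fun v => LinearMap.exists_rightInverse_of_surjective (Rep.homAt S.g v).hom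
    (LinearMap.range_eq_top.2 (Rep.shortExact_homAt hS v).2.1)
  replace hρ : ∀ v x, ρ v (Rep.homAt S.f v x) = x := fun v x => LinearMap.congr_fun (hρ v) x
  replace hσ : ∀ v x, Rep.homAt S.g v (σ v x) = x := fun v x => LinearMap.congr_fun (hσ v) x
  obtain ⟨h, hh⟩ := H fun s t a => (Rep.homAt φ s).hom ∘ₗ
    (ρ s ∘ₗ (S.X₂.act a).hom - (S.X₁.act a).hom ∘ₗ ρ t) ∘ₗ σ t
  refine ⟨homMk (fun v => (Rep.homAt φ v).hom ∘ₗ ρ v + h v ∘ₗ (Rep.homAt S.g v).hom) ?_, ?_⟩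
  · intro s t a x
    obtain ⟨r, hr⟩ := (Rep.shortExact_homAt hS t).2.2 (x - σ t (Rep.homAt S.g t x))
      (by rw [map_sub, hσ, sub_self])
    have h1 := hh a (Rep.homAt S.g t x)
    -- The failure of `ρ` to be natural vanishes on the kernel of `g`, so it only depends on `g x`.
    have h2 : ρ s (S.X₂.act a x) - S.X₁.act a (ρ t x) =
        ρ s (S.X₂.act a (σ t (Rep.homAt S.g t x))) -
          S.X₁.act a (ρ t (σ t (Rep.homAt S.g t x))) := by
      rw [← sub_eq_zero, sub_sub_sub_comm, ← map_sub, ← map_sub, ← map_sub, ← map_sub, ← hr,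
        ← Rep.homAt_act, hρ, hρ, sub_self]
    have h3 : Rep.homAt φ s (ρ s (S.X₂.act a x)) - Y.act a (Rep.homAt φ t (ρ t x)) =
        Y.act a (h t (Rep.homAt S.g t x)) - h s (X.act a (Rep.homAt S.g t x)) := by
      rw [← h1, ← Rep.homAt_act, ← map_sub, h2]
      rfl
    have h4 := Rep.homAt_act S.g a x
    change Rep.homAt φ s (ρ s (S.X₂.act a x)) + h s (Rep.homAt S.g s (S.X₂.act a x)) =
      Y.act a (Rep.homAt φ t (ρ t x) + h t (Rep.homAt S.g t x))
    rw [h4, map_add]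
    exact (sub_eq_sub_iff_add_eq_add.1 h3).trans (add_comm _ _)
  · refine Rep.hom_ext fun v x => ?_
    change Rep.homAt φ v (ρ v (Rep.homAt S.f v x)) + h v (Rep.homAt S.g v (Rep.homAt S.f v x)) =
      Rep.homAt φ v x
    have h1 : Rep.homAt S.g v (Rep.homAt S.f v x) = 0 :=
      ConcreteCategory.congr_hom (NatTrans.congr_app S.zero _) x
    rw [hρ, h1, map_zero, add_zero]

/-- The vertexwise direct sum of `Y` and `X`, on which an arrow `a` acts by the matrix with entries
`Y a`, `φ a` and `X a`. -/
def cochainExtension (X Y : Rep K n ε)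
    (φ : ∀ ⦃s t : Vertex n ε⦄, (s ⟶ t) → (X.space t →ₗ[K] Y.space s)) : Rep K n ε :=
  repMk (fun v => ModuleCat.of K (Y.space v × X.space v)) fun _ _ a => ModuleCat.ofHom
    (((Y.act a).hom ∘ₗ LinearMap.fst K _ _ + φ a ∘ₗ LinearMap.snd K _ _).prod
      ((X.act a).hom ∘ₗ LinearMap.snd K _ _))

/-- If `Ext¹(X, Y) = 0`, then every family `φ` indexed by the arrows is a coboundary, namely of the
`Y`-component of a section of the extension defined by `φ`. -/
theorem ExtOneVanishes.exists_cochain {X Y : Rep K n ε} (H : ExtOneVanishes X Y)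
    (φ : ∀ ⦃s t : Vertex n ε⦄, (s ⟶ t) → (X.space t →ₗ[K] Y.space s)) :
      ∃ h : ∀ v : Vertex n ε, X.space v →ₗ[K] Y.space v,
        ∀ ⦃s t : Vertex n ε⦄ (a : s ⟶ t) (x : X.space t),
          φ a x = Y.act a (h t x) - h s (X.act a x) := by
  let E := cochainExtension X Y φ
  have hE {s t : Vertex n ε} (a : s ⟶ t) (y : Y.space t × X.space t) :
      E.act a y = ((Y.act a y.1 + φ a y.2, X.act a y.2) : Y.space s × X.space s) := by
    rw [show E.act a = _ from repMk_act _ _ a]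
    rfl
  let i : Y ⟶ E := homMk (fun v => LinearMap.inl K (Y.space v) (X.space v)) fun s t a x => by
    refine Eq.trans (b := (Y.act a x + φ a 0, X.act a 0)) ?_ (hE a (x, 0)).symm
    rw [map_zero, map_zero, add_zero]
    rfl
  let p : E ⟶ X := homMk (fun v => LinearMap.snd K (Y.space v) (X.space v)) fun s t a x =>
    congrArg Prod.snd (hE a x)
  let S : ShortComplex (Rep K n ε) := ShortComplex.mk i p (by ext; rfl)
  have hi : Mono i := by
    rw [NatTrans.mono_iff_mono_app]
    intro v
    let v : Vertex n ε := Opposite.unop (show (Vertex n ε)ᵒᵖ from v)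
    exact (ModuleCat.mono_iff_injective _).2
      (LinearMap.inl_injective (R := K) (M := Y.space v) (M₂ := X.space v))
  have hp : Epi p := by
    rw [NatTrans.epi_iff_epi_app]
    intro v
    let v : Vertex n ε := Opposite.unop (show (Vertex n ε)ᵒᵖ from v)
    exact (ModuleCat.epi_iff_surjective _).2
      (LinearMap.snd_surjective (R := K) (M := Y.space v) (M₂ := X.space v))
  have hk : S.Exact := by
    refine ShortComplex.exact_of_f_is_kernel _ (KernelFork.IsLimit.ofι' _ _ fun {W} k hk => ?_)
    have hk' (v : Vertex n ε) (w : W.space v) : (Rep.homAt k v w : Y.space v × X.space v).2 = 0 :=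
      ConcreteCategory.congr_hom (NatTrans.congr_app hk _) w
    refine ⟨homMk (fun v => LinearMap.fst K (Y.space v) (X.space v) ∘ₗ (Rep.homAt k v).hom)
      fun s t a w => ?_, ?_⟩
    · have h1 := congrArg Prod.fst ((Rep.homAt_act k a w).trans (hE a _))
      have h0 := (congrArg (φ a) (hk' t w)).trans (map_zero _)
      exact h1.trans ((congrArg (_ + ·) h0).trans (add_zero _))
    · exact Rep.hom_ext fun v w => Prod.ext rfl (hk' v w).symm
  have hS : S.ShortExact := { exact := hk }
  let := HasExt.standard (Rep K n ε)
  have : Subsingleton (Abelian.Ext.{u + 1} X Y 1) := H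
  -- The class of the extension is zero, so the identity of `X` lifts to a section `σ`.
  obtain ⟨x₂, hx₂⟩ := Abelian.Ext.covariant_sequence_exact₃ X hS (Abelian.Ext.mk₀ (𝟙 X))
    (zero_add 1) (Subsingleton.elim _ _)
  obtain ⟨σ, rfl⟩ := Abelian.Ext.addEquiv₀.symm.surjective x₂
  have hσ : σ ≫ p = 𝟙 X := by
    apply Abelian.Ext.addEquiv₀.symm.injective
    refine Eq.trans ?_ hx₂
    simp [S]
  replace hσ (v : Vertex n ε) (x : X.space v) : (Rep.homAt σ v x : Y.space v × X.space v).2 = x :=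
    ConcreteCategory.congr_hom (NatTrans.congr_app hσ _) x
  refine ⟨fun v => - (LinearMap.fst K (Y.space v) (X.space v)) ∘ₗ (Rep.homAt σ v).hom, ?_⟩
  intro s t a x
  have h1 := congrArg Prod.fst ((Rep.homAt_act σ a x).trans (hE a _))
  have h2 : (Rep.homAt σ s (X.act a x) : Y.space s × X.space s).1 =
      Y.act a (Rep.homAt σ t x : Y.space t × X.space t).1 + φ a x := by
    exact h1.trans (congrArg (_ + ·) (congrArg (φ a) (hσ t x)))
  have key (y₁ : Y.space s) (y₂ : Y.space t) (hy : y₁ = Y.act a y₂ + φ a x) :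
      φ a x = Y.act a (-y₂) - -y₁ := by
    rw [hy, map_neg]
    abel
  exact key _ _ h2

end

/-! ### Interval modules and their splitting off -/

section

variable {K : Type u} [Field K] {n : ℕ} {ε : ℕ → Side}

instance : DecidableEq (Vertex n ε) := fun v w =>
  decidable_of_iff (v.idx = w.idx) Vertex.ext_iff.symm

theorem arrow_idx {s t : Vertex n ε} (e : s ⟶ t) :
    (t.idx = s.idx + 1 ∧ ε s.idx = Side.over) ∨ (s.idx = t.idx + 1 ∧ ε t.idx = Side.under) := by
  change Arrow n ε s t at e
  cases e with
  | a _ _ h hε => exact Or.inl ⟨h, hε⟩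
  | aStar _ _ h hε => exact Or.inr ⟨h, hε⟩

instance (s t : Vertex n ε) : Subsingleton (s ⟶ t) where
  allEq e e' := by
    change Arrow n ε s t at e e'
    cases e with
    | a _ _ h hε =>
      cases e' with
      | a => rfl
      | aStar _ _ h' => omega
    | aStar _ _ h hε =>
      cases e' with
      | a _ _ h' => omega
      | aStar => rfl

theorem false_of_arrow_of_arrow {s t : Vertex n ε} (e : s ⟶ t) (e' : t ⟶ s) : False := by
  rcases arrow_idx e' with h1 | h1 <;> rcases arrow_idx e with h2 | h2 <;> try omega
  all_goals rw [h1.2] at h2; exact absurd h2.2 (by simp)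

/-- The module `X` is an interval module with support `[a, b]`: it has a basis vector at each vertex
of the interval and is zero elsewhere, and the arrows inside the interval carry basis vectors to
basis vectors. Total families are used, with `vec v = 0` off the interval, so that no casts between
vertices are needed; `coord` is the family of coordinates. -/
structure IntervalBasis (X : Rep K n ε) (a b : ℕ) where
  one_le : 1 ≤ a
  le : a ≤ b
  le_n : b ≤ n
  vec : ∀ v : Vertex n ε, X.space v
  coord : ∀ v : Vertex n ε, X.space v →ₗ[K] K
  coord_smul_vec : ∀ v x, coord v x • vec v = x
  coord_vec : ∀ v : Vertex n ε, v.idx ∈ Set.Icc a b → coord v (vec v) = 1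
  vec_eq_zero : ∀ v : Vertex n ε, v.idx ∉ Set.Icc a b → vec v = 0
  act_vec : ∀ ⦃s t : Vertex n ε⦄ (e : s ⟶ t), s.idx ∈ Set.Icc a b → t.idx ∈ Set.Icc a b →
    X.act e (vec t) = vec s

/-- The vectors `g` and the functionals `f` exhibit the interval module on `[a, b]` as a retract of
the restriction of `X` to the vertices `1, …, N`: `g` is a morphism from the interval module, `f` a
morphism to it, and `f` after `g` is the identity. Both families are zero off `[a, b]`, so that
one equation per arrow covers arrows inside the interval and arrows leaving or entering it. -/
structure IsIntervalRetract (X : Rep K n ε) (a b N : ℕ) (g : ∀ v : Vertex n ε, X.space v)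
    (f : ∀ v : Vertex n ε, X.space v →ₗ[K] K) : Prop where
  one_le : 1 ≤ a
  le : a ≤ b
  vec_eq_zero : ∀ v : Vertex n ε, v.idx ∉ Set.Icc a b → g v = 0
  coord_eq_zero : ∀ v : Vertex n ε, v.idx ∉ Set.Icc a b → f v = 0
  coord_vec : ∀ v : Vertex n ε, v.idx ∈ Set.Icc a b → f v (g v) = 1
  act_vec : ∀ ⦃s t : Vertex n ε⦄ (e : s ⟶ t), s.idx ≤ N → t.idx ≤ N → t.idx ∈ Set.Icc a b →
    X.act e (g t) = g s
  coord_act : ∀ ⦃s t : Vertex n ε⦄ (e : s ⟶ t), s.idx ≤ N → t.idx ≤ N → s.idx ∈ Set.Icc a b →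
    ∀ x, f s (X.act e x) = f t x

namespace IsIntervalRetract

variable {X : Rep K n ε} {a b : ℕ} {g : ∀ v : Vertex n ε, X.space v}
  {f : ∀ v : Vertex n ε, X.space v →ₗ[K] K}

/-- For a brick, the idempotent `x ↦ f x • g` of a retract is the identity. -/
theorem nonempty_intervalBasis (h : IsIntervalRetract X a b n g f) (hX : X.IsBrick) (hb : b ≤ n) :
    Nonempty (IntervalBasis X a b) := by
  let p : X ⟶ X := homMk (fun v => (f v).smulRight (g v)) fun s t e x => by
    simp only [LinearMap.smulRight_apply, map_smul]
    by_cases hs : s.idx ∈ Set.Icc a b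
    · rw [h.coord_act e s.le_n t.le_n hs]
      by_cases ht : t.idx ∈ Set.Icc a b
      · rw [h.act_vec e s.le_n t.le_n ht]
      · rw [h.coord_eq_zero t ht, LinearMap.zero_apply, zero_smul, zero_smul]
    · rw [h.coord_eq_zero s hs, LinearMap.zero_apply, zero_smul]
      by_cases ht : t.idx ∈ Set.Icc a b
      · rw [h.act_vec e s.le_n t.le_n ht, h.vec_eq_zero s hs, smul_zero]
      · rw [h.coord_eq_zero t ht, LinearMap.zero_apply, zero_smul]
  have hp (v : Vertex n ε) (x : X.space v) : Rep.homAt p v x = f v x • g v := rfl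
  have hpp : p ≫ p = p := Rep.hom_ext fun v x => by
    change Rep.homAt p v (Rep.homAt p v x) = _
    rw [hp, hp, map_smul, smul_eq_mul]
    by_cases hv : v.idx ∈ Set.Icc a b
    · rw [h.coord_vec v hv, mul_one]
    · rw [h.vec_eq_zero v hv, smul_zero, smul_zero]
  have hp0 : p ≠ 0 := by
    intro h0
    let v : Vertex n ε := ⟨a, h.one_le, h.le.trans hb⟩
    have hv : v.idx ∈ Set.Icc a b := ⟨le_rfl, h.le⟩
    have h1 : Rep.homAt p v (g v) = 0 := by rw [h0]; rfl
    rw [hp, h.coord_vec v hv, one_smul] at h1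
    have := h.coord_vec v hv
    rw [h1, map_zero] at this
    exact zero_ne_one this
  have := hX.isIso_of_ne_zero p hp0
  have hp1 : p = 𝟙 X := by rw [← cancel_epi p, hpp, Category.comp_id]
  exact ⟨{
    one_le := h.one_le
    le := h.le
    le_n := hb
    vec := g
    coord := f
    coord_smul_vec := fun v x => by rw [← hp, hp1]; rfl
    coord_vec := h.coord_vec
    vec_eq_zero := h.vec_eq_zero
    act_vec := fun s t e _ ht => h.act_vec e s.le_n t.le_n ht }⟩

/-- A retract of the part up to `b` which is killed along the arrow between `b` and `b + 1` is a
retract of the whole module. -/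
theorem widen (h : IsIntervalRetract X a b b g f)
    (hg : ∀ ⦃s t : Vertex n ε⦄ (e : s ⟶ t), t.idx = b → s.idx = b + 1 → X.act e (g t) = 0)
    (hf : ∀ ⦃s t : Vertex n ε⦄ (e : s ⟶ t), s.idx = b → t.idx = b + 1 → ∀ x, f s (X.act e x) = 0) :
    IsIntervalRetract X a b n g f where
  one_le := h.one_le
  le := h.le
  vec_eq_zero := h.vec_eq_zero
  coord_eq_zero := h.coord_eq_zero
  coord_vec := h.coord_vec
  act_vec s t e _ _ ht := by
    by_cases hs : s.idx ≤ b
    · exact h.act_vec e hs ht.2 ht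
    · have := arrow_idx e
      have := ht.2
      rw [hg e (by omega) (by omega), h.vec_eq_zero s fun h => hs h.2]
  coord_act s t e _ _ hs x := by
    by_cases ht : t.idx ≤ b
    · exact h.coord_act e hs.2 ht hs x
    · have := arrow_idx e
      have := hs.2
      rw [hf e (by omega) (by omega), h.coord_eq_zero t fun h => ht h.2, LinearMap.zero_apply]

/-- A vector and a functional at one vertex give a retract, if the vector is killed by an arrow acting
to the left, and the functional vanishes on the image of an arrow acting from the left. -/
theorem single (v : Vertex n ε) (y : X.space v) (φ : X.space v →ₗ[K] K) (hy : φ y = 1)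
    (hg : ∀ ⦃w : Vertex n ε⦄ (e : w ⟶ v), w.idx < v.idx → X.act e y = 0)
    (hf : ∀ ⦃w : Vertex n ε⦄ (e : v ⟶ w), w.idx < v.idx → ∀ x, φ (X.act e x) = 0) :
    IsIntervalRetract X v.idx v.idx v.idx (Pi.single v y) (Pi.single v φ) where
  one_le := v.one_le
  le := le_rfl
  vec_eq_zero w hw := Pi.single_eq_of_ne (by rintro rfl; simp at hw) _
  coord_eq_zero w hw := Pi.single_eq_of_ne (by rintro rfl; simp at hw) _
  coord_vec w hw := by
    obtain rfl : w = v := Vertex.ext (by simpa using hw)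
    simpa using hy
  act_vec s t e hs _ ht := by
    obtain rfl : t = v := Vertex.ext (by simpa using ht)
    have := arrow_idx e
    have hst : s ≠ t := by rintro rfl; omega
    rw [Pi.single_eq_same, Pi.single_eq_of_ne hst, hg e (by omega)]
  coord_act s t e _ ht hs x := by
    obtain rfl : s = v := Vertex.ext (by simpa using hs)
    have := arrow_idx e
    have hst : t ≠ s := by rintro rfl; omega
    rw [Pi.single_eq_same, Pi.single_eq_of_ne hst, hf e (by omega), LinearMap.zero_apply]

/-- A retract ending at `v` is continued to the next vertex `w` by a vector `y` and a functional `φ`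
compatible with the arrow between `v` and `w`. -/
theorem extend {v w : Vertex n ε} (hvw : w.idx = v.idx + 1)
    (h : IsIntervalRetract X a v.idx v.idx g f) (y : X.space w) (φ : X.space w →ₗ[K] K)
    (hy : φ y = 1)
    (hr : ∀ e : w ⟶ v, X.act e (g v) = y ∧ ∀ x, φ (X.act e x) = f v x)
    (hl : ∀ e : v ⟶ w, X.act e y = g v ∧ ∀ x, f v (X.act e x) = φ x) :
    IsIntervalRetract X a w.idx w.idx (Function.update g w y) (Function.update f w φ) where
  one_le := h.one_le
  le := by have := h.le; omega
  vec_eq_zero u hu := by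
    have hne : u ≠ w := by rintro rfl; exact hu ⟨by have := h.le; omega, le_rfl⟩
    rw [Function.update_of_ne hne, h.vec_eq_zero u fun hu' => hu ⟨hu'.1, by have := hu'.2; omega⟩]
  coord_eq_zero u hu := by
    have hne : u ≠ w := by rintro rfl; exact hu ⟨by have := h.le; omega, le_rfl⟩
    rw [Function.update_of_ne hne, h.coord_eq_zero u fun hu' => hu ⟨hu'.1, by have := hu'.2; omega⟩]
  coord_vec u hu := by
    by_cases hne : u = w
    · subst hne; simpa using hy
    · rw [Function.update_of_ne hne, Function.update_of_ne hne]
      have : u.idx ≠ w.idx := fun h => hne (Vertex.ext h)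
      exact h.coord_vec u ⟨hu.1, by have := hu.2; omega⟩
  act_vec s t e hs ht hti := by
    have he := arrow_idx e
    by_cases hs' : s = w
    · subst hs'
      obtain rfl : t = v := Vertex.ext (by omega)
      have hne : t ≠ s := by rintro rfl; omega
      rw [Function.update_of_ne hne, Function.update_self, (hr e).1]
    · have : s.idx ≠ w.idx := fun h => hs' (Vertex.ext h)
      rw [Function.update_of_ne hs']
      by_cases ht' : t = w
      · subst ht'
        obtain rfl : s = v := Vertex.ext (by omega)
        rw [Function.update_self, (hl e).1]
      · have : t.idx ≠ w.idx := fun h => ht' (Vertex.ext h)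
        rw [Function.update_of_ne ht', h.act_vec e (by omega) (by omega) ⟨hti.1, by omega⟩]
  coord_act s t e hs ht hsi x := by
    have he := arrow_idx e
    by_cases hs' : s = w
    · subst hs'
      obtain rfl : t = v := Vertex.ext (by omega)
      have hne : t ≠ s := by rintro rfl; omega
      rw [Function.update_of_ne hne, Function.update_self, (hr e).2]
    · have : s.idx ≠ w.idx := fun h => hs' (Vertex.ext h)
      rw [Function.update_of_ne hs']
      by_cases ht' : t = w
      · subst ht'
        obtain rfl : s = v := Vertex.ext (by omega)
        rw [Function.update_self, (hl e).2]
      · have : t.idx ≠ w.idx := fun h => ht' (Vertex.ext h)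
        rw [Function.update_of_ne ht', h.coord_act e (by omega) (by omega) ⟨hsi.1, by omega⟩]

end IsIntervalRetract

/-- Every nonzero vector and every nonzero functional of `X` at `v` is the last term of an interval
retract of the part of `X` up to `v`; moreover `X` vanishes up to `v` if it vanishes at `v`. -/
structure LeftGeneric (X : Rep K n ε) (v : Vertex n ε) : Prop where
  vec : ∀ x : X.space v, x ≠ 0 → ∃ a g f, IsIntervalRetract X a v.idx v.idx g f ∧ g v = x
  coord : ∀ φ : X.space v →ₗ[K] K, φ ≠ 0 →
    ∃ a g f, IsIntervalRetract X a v.idx v.idx g f ∧ f v = φ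
  eq_zero : Subsingleton (X.space v) → ∀ w : Vertex n ε, w.idx ≤ v.idx → Subsingleton (X.space w)

theorem exists_coord_eq_one {V : Type*} [AddCommGroup V] [Module K V] (W : Submodule K V) {x : V}
    (hx : x ∉ W) : ∃ φ : V →ₗ[K] K, φ x = 1 ∧ ∀ w ∈ W, φ w = 0 := by
  obtain ⟨φ, h1, h2⟩ := Submodule.exists_le_ker_of_notMem hx
  refine ⟨(φ x)⁻¹ • φ, by simp [h1], fun w hw => ?_⟩
  have : φ w = 0 := h2 hw
  simp [this]

theorem LeftGeneric.of_idx_eq_one (X : Rep K n ε) {v : Vertex n ε} (hv : v.idx = 1) :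
    LeftGeneric X v where
  vec x hx := by
    obtain ⟨φ, h1, -⟩ := exists_coord_eq_one (K := K) ⊥ (by simpa using hx)
    exact ⟨_, _, _, .single v x φ h1 (fun w _ hw => absurd w.one_le (by omega))
      (fun w _ hw => absurd w.one_le (by omega)), Pi.single_eq_same _ _⟩
  coord φ hφ := by
    obtain ⟨x, hx⟩ := LinearMap.surjective_of_ne_zero hφ 1
    exact ⟨_, _, _, .single v x φ hx (fun w _ hw => absurd w.one_le (by omega))
      (fun w _ hw => absurd w.one_le (by omega)), Pi.single_eq_same _ _⟩
  eq_zero h w hw := by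
    obtain rfl : w = v := Vertex.ext (by have := w.one_le; omega)
    exact h

/-- A vector of `X` at `w` outside the image of the injection, or a functional vanishing on this image,
starts a new interval at `w`; the others continue an interval ending at `v`. -/
theorem LeftGeneric.succ_under {X : Rep K n ε} {v w : Vertex n ε} (hvw : w.idx = v.idx + 1)
    (e : w ⟶ v) (h : LeftGeneric X v) (he : Function.Injective (X.act e)) : LeftGeneric X w := by
  have hempty (e' : v ⟶ w) : False := false_of_arrow_of_arrow e e'
  have hlt {u : Vertex n ε} (hu : u.idx < w.idx) (hu' : Nonempty (u ⟶ w) ∨ Nonempty (w ⟶ u)) :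
      u = v := by
    rcases hu' with ⟨⟨e'⟩⟩ | ⟨⟨e'⟩⟩ <;> have := arrow_idx e' <;> exact Vertex.ext (by omega)
  have hext {a g f} (hr : IsIntervalRetract X a v.idx v.idx g f) (φ : X.space w →ₗ[K] K)
      (hφ : ∀ x, φ (X.act e x) = f v x) :=
    hr.extend hvw (X.act e (g v)) φ (by rw [hφ, hr.coord_vec v ⟨hr.le, le_rfl⟩])
      (fun e' => by obtain rfl := Subsingleton.elim e e'; exact ⟨rfl, hφ⟩)
      (fun e' => (hempty e').elim)
  have hsingle (y : X.space w) (φ : X.space w →ₗ[K] K) (hy : φ y = 1)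
      (hφ : ∀ x, φ (X.act e x) = 0) :=
    IsIntervalRetract.single w y φ hy
      (fun u e' hu => by obtain rfl := hlt hu (.inl ⟨e'⟩); exact (hempty e').elim)
      (fun u e' hu => by
        obtain rfl := hlt hu (.inr ⟨e'⟩); obtain rfl := Subsingleton.elim e e'; exact hφ)
  refine ⟨fun y hy => ?_, fun φ hφ => ?_, fun hs u hu => ?_⟩
  · by_cases hmem : y ∈ LinearMap.range (X.act e).hom
    · obtain ⟨x, rfl⟩ := hmem
      obtain ⟨a, g, f, hr, rfl⟩ := h.vec x (by rintro rfl; simp at hy)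
      obtain ⟨r, hr'⟩ := LinearMap.exists_leftInverse_of_injective (X.act e).hom
        (LinearMap.ker_eq_bot.2 he)
      exact ⟨_, _, _, hext hr (f v ∘ₗ r) fun x => congrArg (f v) (LinearMap.congr_fun hr' x),
        Function.update_self _ _ _⟩
    · obtain ⟨φ, h1, h2⟩ := exists_coord_eq_one _ hmem
      exact ⟨_, _, _, hsingle y φ h1 fun x => h2 _ ⟨x, rfl⟩, Pi.single_eq_same _ _⟩
  · by_cases h0 : φ ∘ₗ (X.act e).hom = 0
    · obtain ⟨y, hy⟩ := LinearMap.surjective_of_ne_zero hφ 1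
      exact ⟨_, _, _, hsingle y φ hy (LinearMap.congr_fun h0), Pi.single_eq_same _ _⟩
    · obtain ⟨a, g, f, hr, hf⟩ := h.coord _ h0
      exact ⟨_, _, _, hext hr φ fun x => by rw [hf]; rfl, Function.update_self _ _ _⟩
  · by_cases hu' : u = w
    · exact hu' ▸ hs
    · exact h.eq_zero ⟨fun x y => he (Subsingleton.elim _ _)⟩ u
        (by have : u.idx ≠ w.idx := fun h => hu' (Vertex.ext h)
            omega)

/-- A vector in the kernel of the surjection, or a functional not vanishing on this kernel, starts a
new interval at `w`; the others continue an interval ending at `v`. -/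
theorem LeftGeneric.succ_over {X : Rep K n ε} {v w : Vertex n ε} (hvw : w.idx = v.idx + 1)
    (e : v ⟶ w) (h : LeftGeneric X v) (he : Function.Surjective (X.act e)) : LeftGeneric X w := by
  have hempty (e' : w ⟶ v) : False := false_of_arrow_of_arrow e e'
  have hlt {u : Vertex n ε} (hu : u.idx < w.idx) (hu' : Nonempty (u ⟶ w) ∨ Nonempty (w ⟶ u)) :
      u = v := by
    rcases hu' with ⟨⟨e'⟩⟩ | ⟨⟨e'⟩⟩ <;> have := arrow_idx e' <;> exact Vertex.ext (by omega)
  have hext {a g f} (hr : IsIntervalRetract X a v.idx v.idx g f) (y : X.space w)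
      (hy : X.act e y = g v) :=
    hr.extend hvw y (f v ∘ₗ (X.act e).hom)
      ((congrArg (f v) hy).trans (hr.coord_vec v ⟨hr.le, le_rfl⟩))
      (fun e' => (hempty e').elim)
      (fun e' => by obtain rfl := Subsingleton.elim e e'; exact ⟨hy, fun x => rfl⟩)
  have hsingle (y : X.space w) (φ : X.space w →ₗ[K] K) (hy : φ y = 1)
      (hy' : X.act e y = 0) :=
    IsIntervalRetract.single w y φ hy
      (fun u e' hu => by
        obtain rfl := hlt hu (.inl ⟨e'⟩); obtain rfl := Subsingleton.elim e e'; exact hy')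
      (fun u e' hu => by obtain rfl := hlt hu (.inr ⟨e'⟩); exact (hempty e').elim)
  refine ⟨fun y hy => ?_, fun φ hφ => ?_, fun hs u hu => ?_⟩
  · by_cases h0 : X.act e y = 0
    · obtain ⟨φ, h1, -⟩ := exists_coord_eq_one (K := K) ⊥ (by simpa using hy)
      exact ⟨_, _, _, hsingle y φ h1 h0, Pi.single_eq_same _ _⟩
    · obtain ⟨a, g, f, hr, hg⟩ := h.vec _ h0
      exact ⟨_, _, _, hext hr y hg.symm, Function.update_self _ _ _⟩
  · by_cases hker : LinearMap.ker (X.act e).hom ≤ LinearMap.ker φ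
    · obtain ⟨ψ, hψ⟩ : ∃ ψ : X.space v →ₗ[K] K, ψ ∘ₗ (X.act e).hom = φ := by
        obtain ⟨r, hr⟩ := LinearMap.exists_rightInverse_of_surjective (X.act e).hom
          (LinearMap.range_eq_top.2 he)
        refine ⟨φ ∘ₗ r, LinearMap.ext fun y => ?_⟩
        rw [← sub_eq_zero]
        have h1 : r (X.act e y) - y ∈ LinearMap.ker (X.act e).hom := by
          rw [LinearMap.mem_ker, map_sub, sub_eq_zero]
          exact LinearMap.congr_fun hr (X.act e y)
        exact (map_sub φ _ _).symm.trans (hker h1)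
      obtain ⟨a, g, f, hr, rfl⟩ := h.coord ψ (by rintro rfl; exact hφ (by simp [← hψ]))
      obtain ⟨y, hy⟩ := he (g v)
      exact ⟨_, _, _, hext hr y hy, by rw [Function.update_self, hψ]⟩
    · obtain ⟨y, hy, hy'⟩ := SetLike.not_le_iff_exists.1 hker
      refine ⟨_, _, _, hsingle ((φ y)⁻¹ • y) φ (by simp [show φ y ≠ 0 from hy']) ?_,
        Pi.single_eq_same _ _⟩
      rw [map_smul, show X.act e y = 0 from hy, smul_zero]
  · by_cases hu' : u = w
    · exact hu' ▸ hs
    · exact h.eq_zero he.subsingleton u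
        (by have : u.idx ≠ w.idx := fun h => hu' (Vertex.ext h)
            omega)

/-- Every brick is an interval module. If it were not, no interval retract could exist, so every
arrow would act by an injection to the right or a surjection to the left, and `LeftGeneric` would
reach the last vertex, where it provides an interval retract. -/
theorem Rep.IsBrick.exists_intervalBasis {X : Rep K n ε} (hX : X.IsBrick) :
    ∃ a b, Nonempty (IntervalBasis X a b) := by
  by_contra! hno
  have hretract (a b g f) (hb : b ≤ n) (h : IsIntervalRetract X a b n g f) : False :=
    (hno a b).false (h.nonempty_intervalBasis hX hb).some
  have key : ∀ m, ∀ v : Vertex n ε, v.idx = m + 1 → LeftGeneric X v := by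
    intro m
    induction m with
    | zero => exact fun v hv => .of_idx_eq_one X hv
    | succ m ih =>
      intro w hw
      let v : Vertex n ε := ⟨m + 1, by omega, by have := w.le_n; omega⟩
      have hvw : w.idx = v.idx + 1 := hw
      have hv := ih v rfl
      rcases hε : ε v.idx with _ | _
      · let e : w ⟶ v := Arrow.aStar v w hvw hε
        refine hv.succ_under hvw e ((injective_iff_map_eq_zero (X.act e).hom).2 fun x hx => ?_)
        by_contra hx0
        obtain ⟨a, g, f, hr, rfl⟩ := hv.vec x hx0
        refine hretract _ _ _ _ v.le_n (hr.widen (fun s t e' ht hs => ?_) fun s t e' hs ht => ?_)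
        · obtain rfl : t = v := Vertex.ext ht
          obtain rfl : s = w := Vertex.ext (by omega)
          obtain rfl := Subsingleton.elim e e'
          exact hx
        · rcases arrow_idx e' with h1 | h1
          · rw [hs, hε] at h1; exact absurd h1.2 (by simp)
          · omega
      · let e : v ⟶ w := Arrow.a v w hvw hε
        refine hv.succ_over hvw e fun y => ?_
        by_contra hy
        obtain ⟨φ, h1, h2⟩ := exists_coord_eq_one (K := K) (LinearMap.range (X.act e).hom) hy
        obtain ⟨a, g, f, hr, rfl⟩ := hv.coord φ (by rintro rfl; simp at h1)
        refine hretract _ _ _ _ v.le_n (hr.widen (fun s t e' ht hs => ?_) fun s t e' hs ht x => ?_)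
        · rcases arrow_idx e' with h1 | h1
          · omega
          · rw [ht, hε] at h1; exact absurd h1.2 (by simp)
        · obtain rfl : s = v := Vertex.ext hs
          obtain rfl : t = w := Vertex.ext (by omega)
          obtain rfl := Subsingleton.elim e e'
          exact h2 _ ⟨x, rfl⟩
  obtain ⟨m, hm⟩ := hX.support_nonempty
  obtain ⟨h1, u, rfl, hu⟩ := Rep.mem_support.1 hm
  let v : Vertex n ε := ⟨n, u.one_le.trans u.le_n, le_rfl⟩
  have hv := key (n - 1) v (by have := v.one_le; change n = _; change 1 ≤ n at this; omega)
  have hnt : Nontrivial (X.space v) := by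
    by_contra h
    exact not_subsingleton_iff_nontrivial.2 hu
      (hv.eq_zero (not_nontrivial_iff_subsingleton.1 h) u u.le_n)
  obtain ⟨x, hx⟩ := exists_ne (0 : X.space v)
  obtain ⟨a, g, f, hr, -⟩ := hv.vec x hx
  exact hretract _ _ _ _ le_rfl hr

end

/-! ### Homomorphisms and extensions between interval modules -/

section

variable {K : Type u} [Field K] {n : ℕ} {ε : ℕ → Side}

namespace IntervalBasis

variable {X Y : Rep K n ε} {a b c d : ℕ}

theorem subsingleton (B : IntervalBasis X a b) {v : Vertex n ε} (hv : v.idx ∉ Set.Icc a b) :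
    Subsingleton (X.space v) :=
  subsingleton_of_forall_eq 0 fun x => by
    rw [← B.coord_smul_vec v x, B.vec_eq_zero v hv, smul_zero]

theorem vec_ne_zero (B : IntervalBasis X a b) {v : Vertex n ε} (hv : v.idx ∈ Set.Icc a b) :
    B.vec v ≠ 0 := by
  intro h
  have := B.coord_vec v hv
  rw [h, map_zero] at this
  exact zero_ne_one this

theorem nontrivial_iff (B : IntervalBasis X a b) (v : Vertex n ε) :
    Nontrivial (X.space v) ↔ v.idx ∈ Set.Icc a b := by
  constructor
  · intro h
    by_contra hv
    exact not_subsingleton_iff_nontrivial.2 h (B.subsingleton hv)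
  · exact fun hv => nontrivial_of_ne _ _ (B.vec_ne_zero hv)

theorem act_vec_of_mem (B : IntervalBasis X a b) {s t : Vertex n ε} (e : s ⟶ t)
    (ht : t.idx ∈ Set.Icc a b) : X.act e (B.vec t) = B.vec s := by
  by_cases hs : s.idx ∈ Set.Icc a b
  · exact B.act_vec e hs ht
  · exact (B.subsingleton hs).elim _ _

theorem isFinite (B : IntervalBasis X a b) : X.IsFinite := fun v =>
  Module.Finite.of_surjective (LinearMap.toSpanSingleton K _ (B.vec v))
    fun x => ⟨B.coord v x, B.coord_smul_vec v x⟩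

theorem homAt_eq_smul (B : IntervalBasis X a b) (C : IntervalBasis Y c d)
    (f : ∀ v : Vertex n ε, X.space v →ₗ[K] Y.space v) (v : Vertex n ε) (x : X.space v) :
    f v x = (B.coord v x * C.coord v (f v (B.vec v))) • C.vec v := by
  conv_lhs => rw [← B.coord_smul_vec v x, map_smul, ← C.coord_smul_vec v (f v (B.vec v)), smul_smul]

theorem coord_apply_vec_eq_zero (B : IntervalBasis X a b) (C : IntervalBasis Y c d)
    (f : ∀ v : Vertex n ε, X.space v →ₗ[K] Y.space v) {v : Vertex n ε}
    (hv : ¬(v.idx ∈ Set.Icc a b ∧ v.idx ∈ Set.Icc c d)) : C.coord v (f v (B.vec v)) = 0 := by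
  by_cases h : v.idx ∈ Set.Icc a b
  · rw [(C.subsingleton fun h' => hv ⟨h, h'⟩).elim (f v (B.vec v)) 0, map_zero]
  · rw [B.vec_eq_zero v h, map_zero, map_zero]

theorem act_smul_vec (C : IntervalBasis Y c d) {k : K} {s t : Vertex n ε} (e : s ⟶ t)
    (hk : t.idx ∉ Set.Icc c d → k = 0) : Y.act e (k • C.vec t) = k • C.vec s := by
  rw [map_smul]
  by_cases ht : t.idx ∈ Set.Icc c d
  · rw [C.act_vec_of_mem e ht]
  · rw [hk ht, zero_smul, zero_smul]

theorem scalar_eq_of_hom (B : IntervalBasis X a b) (C : IntervalBasis Y c d) (f : X ⟶ Y)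
    {s t : Vertex n ε} (e : s ⟶ t) (ht : t.idx ∈ Set.Icc a b) (hs : s.idx ∈ Set.Icc c d) :
    C.coord s (Rep.homAt f s (B.vec s)) = C.coord t (Rep.homAt f t (B.vec t)) := by
  have h1 := Rep.homAt_act f e (B.vec t)
  have h2 : Rep.homAt f t (B.vec t) = C.coord t (Rep.homAt f t (B.vec t)) • C.vec t :=
    (C.coord_smul_vec t _).symm
  rw [B.act_vec_of_mem e ht, h2, C.act_smul_vec e fun h =>
    B.coord_apply_vec_eq_zero C (fun v => (Rep.homAt f v).hom) fun h' => h h'.2] at h1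
  rw [h1, map_smul, C.coord_vec s hs, smul_eq_mul, mul_one]

/-- The morphism of interval modules which multiplies by the scalar `H v` at the vertex `v`. -/
def homOfScalar (B : IntervalBasis X a b) (C : IntervalBasis Y c d) (H : Vertex n ε → K)
    (hH : ∀ v : Vertex n ε, ¬(v.idx ∈ Set.Icc a b ∧ v.idx ∈ Set.Icc c d) → H v = 0)
    (hact : ∀ ⦃s t : Vertex n ε⦄, (s ⟶ t) → t.idx ∈ Set.Icc a b → s.idx ∈ Set.Icc c d →
      H s = H t) : X ⟶ Y :=
  homMk (fun v => H v • (B.coord v).smulRight (C.vec v)) fun s t e x => by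
    change H s • B.coord s (X.act e x) • C.vec s = Y.act e (H t • B.coord t x • C.vec t)
    rw [smul_smul, smul_smul, C.act_smul_vec e fun h => by rw [hH t fun h' => h h'.2, zero_mul]]
    by_cases hs : s.idx ∈ Set.Icc c d
    · congr 1
      conv_lhs => rw [← B.coord_smul_vec t x, map_smul, map_smul, smul_eq_mul]
      by_cases ht : t.idx ∈ Set.Icc a b
      · rw [B.act_vec_of_mem e ht, hact e ht hs]
        by_cases hs' : s.idx ∈ Set.Icc a b
        · rw [B.coord_vec s hs', mul_one]
        · rw [← hact e ht hs, hH s fun h => hs' h.1, zero_mul, zero_mul]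
      · rw [hH t fun h => ht h.1, B.vec_eq_zero t ht, map_zero, map_zero, mul_zero, mul_zero,
          zero_mul]
    · rw [C.vec_eq_zero s hs, smul_zero, smul_zero]

theorem homOfScalar_apply (B : IntervalBasis X a b) (C : IntervalBasis Y c d) (H : Vertex n ε → K)
    (hH hact) (v : Vertex n ε) (x : X.space v) :
    Rep.homAt (B.homOfScalar C H hH hact) v x = (H v * B.coord v x) • C.vec v :=
  smul_smul _ _ _

/-- Morphisms between interval modules are scalars on the common interval, equal along each arrow
that starts its action in the first interval and ends it in the second. -/
theorem hom_eq_zero_iff (B : IntervalBasis X a b) (C : IntervalBasis Y c d) :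
    (∀ f : X ⟶ Y, f = 0) ↔ ∀ H : Vertex n ε → K,
      (∀ v : Vertex n ε, ¬(v.idx ∈ Set.Icc a b ∧ v.idx ∈ Set.Icc c d) → H v = 0) →
      (∀ ⦃s t : Vertex n ε⦄, (s ⟶ t) → t.idx ∈ Set.Icc a b → s.idx ∈ Set.Icc c d → H s = H t) →
      ∀ v, H v = 0 := by
  constructor
  · intro h H hH hact v
    by_cases hv : v.idx ∈ Set.Icc a b ∧ v.idx ∈ Set.Icc c d
    · have h1 := B.homOfScalar_apply C H hH hact v (B.vec v)
      rw [h (B.homOfScalar C H hH hact), B.coord_vec v hv.1, mul_one] at h1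
      exact (smul_eq_zero.1 h1.symm).resolve_right (C.vec_ne_zero hv.2)
    · exact hH v hv
  · intro h f
    refine Rep.hom_ext fun v x => ?_
    have h1 := h (fun v => C.coord v (Rep.homAt f v (B.vec v)))
      (fun v hv => B.coord_apply_vec_eq_zero C (fun v => (Rep.homAt f v).hom) hv)
      (fun s t e => B.scalar_eq_of_hom C f e) v
    refine (B.homAt_eq_smul C (fun v => (Rep.homAt f v).hom) v x).trans ?_
    change (_ * C.coord v (Rep.homAt f v (B.vec v))) • _ = _
    rw [h1, mul_zero, zero_smul]
    rfl

/-- The cochain description of `Ext¹` for interval modules, in coordinates. -/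
theorem extOneVanishes_iff (B : IntervalBasis X a b) (C : IntervalBasis Y c d) :
    ExtOneVanishes X Y ↔ ∀ φ : ∀ ⦃s t : Vertex n ε⦄, (s ⟶ t) → K, ∃ H : Vertex n ε → K,
      (∀ v : Vertex n ε, ¬(v.idx ∈ Set.Icc a b ∧ v.idx ∈ Set.Icc c d) → H v = 0) ∧
      ∀ ⦃s t : Vertex n ε⦄ (e : s ⟶ t), t.idx ∈ Set.Icc a b → s.idx ∈ Set.Icc c d →
        H t - H s = φ e := by
  constructor
  · intro h φ
    obtain ⟨f, hf⟩ := h.exists_cochain fun s t e => φ e • (B.coord t).smulRight (C.vec s)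
    refine ⟨fun v => C.coord v (f v (B.vec v)), fun v hv => B.coord_apply_vec_eq_zero C f hv,
      fun s t e ht hs => ?_⟩
    have h1 := hf e (B.vec t)
    change φ e • B.coord t (B.vec t) • C.vec s = _ at h1
    rw [← C.coord_smul_vec t (f t (B.vec t)), C.act_smul_vec e fun h =>
      B.coord_apply_vec_eq_zero C f fun h' => h h'.2, B.coord_vec t ht, one_smul,
      B.act_vec_of_mem e ht] at h1
    have h2 := congrArg (C.coord s) h1
    rw [map_sub, map_smul, map_smul, C.coord_vec s hs, smul_eq_mul, mul_one, smul_eq_mul,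
      mul_one] at h2
    exact h2.symm
  · intro h
    refine ExtOneVanishes.of_cochain fun φ => ?_
    obtain ⟨H, hH, hact⟩ := h fun s t e => C.coord s (φ e (B.vec t))
    refine ⟨fun v => H v • (B.coord v).smulRight (C.vec v), fun s t e x => ?_⟩
    change φ e x = Y.act e (H t • B.coord t x • C.vec t) - H s • B.coord s (X.act e x) • C.vec s
    rw [smul_smul, C.act_smul_vec e fun h => by rw [hH t fun h' => h h'.2, zero_mul]]
    conv_lhs => rw [← B.coord_smul_vec t x, map_smul, ← C.coord_smul_vec s (φ e (B.vec t))]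
    conv_rhs => rw [← B.coord_smul_vec t x]
    by_cases hs : s.idx ∈ Set.Icc c d
    · by_cases ht : t.idx ∈ Set.Icc a b
      · rw [← hact e ht hs, map_smul, map_smul, map_smul, B.act_vec_of_mem e ht, B.coord_vec t ht]
        by_cases hs' : s.idx ∈ Set.Icc a b
        · rw [B.coord_vec s hs']
          simp only [smul_smul, ← sub_smul, smul_eq_mul]
          congr 1
          ring
        · rw [hH s fun h => hs' h.1]
          simp only [smul_smul, ← sub_smul, smul_eq_mul, sub_zero]
          congr 1
          ring
      · simp [B.vec_eq_zero t ht]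
    · simp [C.vec_eq_zero s hs]

/-- Endomorphisms of an interval module are scalars: the scalar at `a` propagates along the
arrows. -/
theorem end_eq_smul (B : IntervalBasis X a b) (f : X ⟶ X) : ∃ k : K, f = k • 𝟙 X := by
  have hstep : ∀ m, a ≤ m → ∀ v w : Vertex n ε, v.idx = a → w.idx = m → m ≤ b →
      B.coord w (Rep.homAt f w (B.vec w)) = B.coord v (Rep.homAt f v (B.vec v)) := by
    intro m hm
    induction m, hm using Nat.le_induction with
    | base =>
      intro v w hv hw _
      obtain rfl : v = w := Vertex.ext (hv.trans hw.symm)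
      rfl
    | succ m hm ih =>
      intro v w hv hw hb
      have := w.le_n
      have := B.one_le
      let u : Vertex n ε := ⟨m, by omega, by omega⟩
      have hu : u.idx = m := rfl
      rw [← ih v u hv rfl (by omega)]
      have huI : u.idx ∈ Set.Icc a b := ⟨by omega, by omega⟩
      have hwI : w.idx ∈ Set.Icc a b := ⟨by omega, by omega⟩
      rcases hε : ε u.idx with _ | _
      · exact B.scalar_eq_of_hom B f (Arrow.aStar u w hw hε : w ⟶ u) huI hwI
      · exact (B.scalar_eq_of_hom B f (Arrow.a u w hw hε : u ⟶ w) hwI huI).symm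
  let v₀ : Vertex n ε := ⟨a, B.one_le, B.le.trans B.le_n⟩
  refine ⟨B.coord v₀ (Rep.homAt f v₀ (B.vec v₀)), Rep.hom_ext fun w x => ?_⟩
  change _ = B.coord v₀ (Rep.homAt f v₀ (B.vec v₀)) • x
  refine (B.homAt_eq_smul B (fun v => (Rep.homAt f v).hom) w x).trans ?_
  change (B.coord w x * B.coord w (Rep.homAt f w (B.vec w))) • B.vec w = _
  by_cases hw : w.idx ∈ Set.Icc a b
  · rw [hstep w.idx hw.1 v₀ w rfl rfl hw.2, mul_comm, mul_smul, B.coord_smul_vec]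
  · exact (B.subsingleton hw).elim _ _

theorem id_ne_zero (B : IntervalBasis X a b) : 𝟙 X ≠ 0 := by
  intro h
  let v : Vertex n ε := ⟨a, B.one_le, B.le.trans B.le_n⟩
  have h1 : Rep.homAt (𝟙 X) v (B.vec v) = 0 := by rw [h]; rfl
  exact B.vec_ne_zero ⟨le_rfl, B.le⟩ h1

theorem isBrick (B : IntervalBasis X a b) : X.IsBrick where
  finite := B.isFinite
  id_ne_zero := B.id_ne_zero
  isIso_of_ne_zero f hf := by
    obtain ⟨k, rfl⟩ := B.end_eq_smul f
    have hk : k ≠ 0 := by rintro rfl; exact hf (zero_smul _ _)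
    exact ⟨k⁻¹ • 𝟙 X, by simp [smul_smul, hk], by simp [smul_smul, hk]⟩

theorem nonempty_end_algEquiv (B : IntervalBasis X a b) : Nonempty (End X ≃ₐ[K] K) := by
  have : Nontrivial (End X) := ⟨𝟙 X, 0, B.id_ne_zero⟩
  refine ⟨(AlgEquiv.ofBijective (Algebra.ofId K (End X))
    ⟨(Algebra.ofId K (End X)).toRingHom.injective, fun f => ?_⟩).symm⟩
  obtain ⟨k, hk⟩ := B.end_eq_smul f
  exact ⟨k, by rw [hk]; exact Algebra.algebraMap_eq_smul_one k⟩

theorem nonempty_iso (B : IntervalBasis X a b) (C : IntervalBasis Y a b) : Nonempty (X ≅ Y) := by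
  classical
  let H (v : Vertex n ε) : K := if v.idx ∈ Set.Icc a b then 1 else 0
  have hH (v : Vertex n ε) (hv : ¬(v.idx ∈ Set.Icc a b ∧ v.idx ∈ Set.Icc a b)) : H v = 0 :=
    if_neg fun h => hv ⟨h, h⟩
  have hact ⦃s t : Vertex n ε⦄ (_ : s ⟶ t) (ht : t.idx ∈ Set.Icc a b) (hs : s.idx ∈ Set.Icc a b) :
      H s = H t := (if_pos hs).trans (if_pos ht).symm
  have key {X Y : Rep K n ε} (B : IntervalBasis X a b) (C : IntervalBasis Y a b) :
      B.homOfScalar C H hH hact ≫ C.homOfScalar B H hH hact = 𝟙 X := by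
    refine Rep.hom_ext fun v x => ?_
    change Rep.homAt (C.homOfScalar B H hH hact) v (Rep.homAt (B.homOfScalar C H hH hact) v x) = x
    by_cases hv : v.idx ∈ Set.Icc a b
    · rw [homOfScalar_apply, homOfScalar_apply, show H v = 1 from if_pos hv, map_smul,
        C.coord_vec v hv, one_mul, one_mul, smul_eq_mul, mul_one, B.coord_smul_vec]
    · exact (B.subsingleton hv).elim _ _
  exact ⟨⟨_, _, key B C, key C B⟩⟩

theorem support_eq (B : IntervalBasis X a b) : X.support = Finset.Icc a b := by
  ext m
  rw [Rep.mem_support, Finset.mem_Icc, Finset.mem_Icc]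
  constructor
  · rintro ⟨-, v, rfl, hv⟩
    exact (B.nontrivial_iff v).1 hv
  · intro hm
    have := B.one_le
    have := B.le_n
    exact ⟨by omega, ⟨m, by omega, by omega⟩, rfl, (B.nontrivial_iff _).2 hm⟩

theorem left_arcOfBrick (B : IntervalBasis X a b) (hX : X.IsBrick) :
    (arcOfBrick ⟨X, hX⟩).left = a - 1 := by
  simp only [arcOfBrick, B.support_eq]
  congr 1
  exact le_antisymm (Finset.min'_le _ _ (Finset.left_mem_Icc.2 B.le))
    (Finset.le_min' _ _ _ fun m hm => (Finset.mem_Icc.1 hm).1)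

theorem right_arcOfBrick (B : IntervalBasis X a b) (hX : X.IsBrick) :
    (arcOfBrick ⟨X, hX⟩).right = b := by
  simp only [arcOfBrick, B.support_eq]
  exact le_antisymm (Finset.max'_le _ _ _ fun m hm => (Finset.mem_Icc.1 hm).2)
    (Finset.le_max' _ _ (Finset.right_mem_Icc.2 B.le))

theorem admissible_arcOfBrick (B : IntervalBasis X a b) (hX : X.IsBrick) :
    (arcOfBrick ⟨X, hX⟩).Admissible ε := by
  classical
  intro m hm
  have hm' := Finset.mem_Ioo.1 hm
  rw [B.left_arcOfBrick, B.right_arcOfBrick] at hm'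
  have h1 : m ∈ (arcOfBrick ⟨X, hX⟩).above ↔ X.MapNeZero m := by
    refine Finset.mem_filter.trans ⟨fun h => h.2, fun h => ⟨hm, h⟩⟩
  rw [h1]
  constructor
  · rintro ⟨i, j, h, hε, rfl, -⟩
    exact hε
  · intro hε
    have := B.one_le
    have := B.le_n
    let i : Vertex n ε := ⟨m, by omega, by omega⟩
    let j : Vertex n ε := ⟨m + 1, by omega, by omega⟩
    refine ⟨i, j, rfl, hε, rfl, fun h0 => ?_⟩
    have hi : i.idx ∈ Set.Icc a b := ⟨show a ≤ m by omega, show m ≤ b by omega⟩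
    have hj : j.idx ∈ Set.Icc a b := ⟨show a ≤ m + 1 by omega, show m + 1 ≤ b by omega⟩
    have h2 := B.act_vec (Arrow.a i j rfl hε : i ⟶ j) hi hj
    rw [h0] at h2
    exact B.vec_ne_zero hi h2.symm

end IntervalBasis

open Classical in
/-- The coordinate on the space of functions on a proposition `P`, which is `K` if `P` holds and
zero otherwise. -/
noncomputable def coordOn (K : Type u) [Field K] (P : Prop) : (PLift P → K) →ₗ[K] K :=
  if h : P then LinearMap.proj ⟨h⟩ else 0

theorem coordOn_apply {P : Prop} (h : P) (x : PLift P → K) : coordOn K P x = x ⟨h⟩ := by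
  rw [coordOn, dif_pos h, LinearMap.proj_apply]

/-- The interval module on `[a, b]` exists; its space at `v` consists of the functions to `K` on the
proposition `v ∈ [a, b]`. -/
theorem exists_intervalBasis (K : Type u) [Field K] {n : ℕ} (ε : ℕ → Side) {a b : ℕ} (ha : 1 ≤ a)
    (hab : a ≤ b) (hb : b ≤ n) : ∃ X : Rep K n ε, Nonempty (IntervalBasis X a b) := by
  let X : Rep K n ε := repMk (fun v => ModuleCat.of K (PLift (v.idx ∈ Set.Icc a b) → K))
    fun s t _ => ModuleCat.ofHom (LinearMap.pi fun _ => coordOn K (t.idx ∈ Set.Icc a b))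
  refine ⟨X, ⟨{
    one_le := ha
    le := hab
    le_n := hb
    vec := fun v => (fun _ => 1 : PLift (v.idx ∈ Set.Icc a b) → K)
    coord := fun v => coordOn K (v.idx ∈ Set.Icc a b)
    coord_smul_vec := fun v x => funext fun (hv : PLift (v.idx ∈ Set.Icc a b)) =>
      (mul_one _).trans (coordOn_apply hv.down x)
    coord_vec := fun v hv => coordOn_apply hv _
    vec_eq_zero := fun v hv => funext fun (h : PLift (v.idx ∈ Set.Icc a b)) => (hv h.down).elim
    act_vec := fun s t e _ ht => ?_ }⟩⟩
  rw [show X.act e = _ from repMk_act _ _ e]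
  exact funext fun _ => coordOn_apply ht _

end

/-! ### The linear equations on the nodes -/

section

/-- For admissible arcs with left endpoints `l` and `l'` over a common interval: at the left end of
that interval, the first arc runs strictly below the second one. One of the two arcs starts at that
node, and the other one passes it. -/
def BelowLeft (ε : ℕ → Side) (l l' : ℕ) : Prop :=
  (l < l' ∧ ε l' = Side.under) ∨ (l' < l ∧ ε l = Side.over)

/-- For admissible arcs with right endpoints `r` and `r'` over a common interval: at the right end
of that interval, the first arc runs strictly above the second one. -/
def AboveRight (ε : ℕ → Side) (r r' : ℕ) : Prop :=
  (r' < r ∧ ε r' = Side.over) ∨ (r < r' ∧ ε r = Side.under)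

/-- The arrow between the vertices `m` and `m + 1` acts from a vertex of the interval `[l + 1, r]`
to a vertex of `[l' + 1, r']`, so that it contributes an equation for maps between the two interval
modules. -/
def ActiveNode (ε : ℕ → Side) (l r l' r' m : ℕ) : Prop :=
  (ε m = Side.over ∧ m + 1 ∈ Set.Icc (l + 1) r ∧ m ∈ Set.Icc (l' + 1) r') ∨
    (ε m = Side.under ∧ m ∈ Set.Icc (l + 1) r ∧ m + 1 ∈ Set.Icc (l' + 1) r')

section Scalars

variable {K : Type*} [Field K] {ε : ℕ → Side} {l r l' r' : ℕ}

theorem Side.under_or_over (s : Side) : s = Side.under ∨ s = Side.over := by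
  cases s <;> simp

/-- If the intervals meet, the active nodes are those inside the common interval, and its two ends
under the respective conditions. -/
theorem activeNode_iff (hl : l < r) (hl' : l' < r') (h₁ : l < r') (h₂ : l' < r) (m : ℕ) :
    ActiveNode ε l r l' r' m ↔ (max l l' < m ∧ m < min r r') ∨
      (m = max l l' ∧ BelowLeft ε l l') ∨ (m = min r r' ∧ AboveRight ε r r') := by
  have hnot : ε m = Side.over ↔ ¬ε m = Side.under := by cases ε m <;> simp
  simp only [ActiveNode, BelowLeft, AboveRight, Set.mem_Icc]
  grind

/-- The homogeneous equations only have the zero solution if and only if there is an extra equation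
at one of the ends of the common interval; its solution `0` propagates from there. -/
theorem scalar_eq_zero_iff (hl : l < r) (hl' : l' < r') :
    (∀ H : ℕ → K, (∀ m, ¬(m ∈ Set.Icc (l + 1) r ∧ m ∈ Set.Icc (l' + 1) r') → H m = 0) →
      (∀ m, ActiveNode ε l r l' r' m → H m = H (m + 1)) → ∀ m, H m = 0) ↔
    (l < r' → l' < r → BelowLeft ε l l' ∨ AboveRight ε r r') := by
  simp only [Set.mem_Icc]
  constructor
  · intro h h₁ h₂
    by_contra! hno
    have h3 := h (fun m => if max l l' < m ∧ m ≤ min r r' then 1 else 0)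
      (fun m hm => if_neg (by omega)) (fun m hm => by
        rw [activeNode_iff hl hl' h₁ h₂] at hm
        rcases hm with hm | ⟨-, hm⟩ | ⟨-, hm⟩
        · rw [if_pos (by omega), if_pos (by omega)]
        · exact absurd hm hno.1
        · exact absurd hm hno.2) (max l l' + 1)
    rw [if_pos (by omega)] at h3
    exact one_ne_zero h3
  · intro h H hH hact
    by_cases hov : l < r' ∧ l' < r
    · rcases h hov.1 hov.2 with hB | hA
      · intro m
        induction m with
        | zero => exact hH 0 (by omega)
        | succ m ih =>
          by_cases hm : max l l' ≤ m ∧ m < min r r'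
          · rw [← hact m, ih]
            rw [activeNode_iff hl hl' hov.1 hov.2]
            rcases hm.1.lt_or_eq with h1 | h1
            · exact .inl ⟨h1, hm.2⟩
            · exact .inr (.inl ⟨h1.symm, hB⟩)
          · exact hH _ (by omega)
      · have key : ∀ k m, min r r' + 1 = m + k → H m = 0 := by
          intro k
          induction k with
          | zero => exact fun m hm => hH m (by omega)
          | succ k ih =>
            intro m hm
            by_cases hm' : max l l' < m
            · rw [hact m, ih (m + 1) (by omega)]
              rw [activeNode_iff hl hl' hov.1 hov.2]
              by_cases h1 : m < min r r'
              · exact .inl ⟨hm', h1⟩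
              · exact .inr (.inr ⟨by omega, hA⟩)
            · exact hH m (by omega)
        intro m
        by_cases hm : m ≤ min r r'
        · exact key (min r r' + 1 - m) m (by omega)
        · exact hH m (by omega)
    · exact fun m => hH m (by omega)

/-- The inhomogeneous equations are solvable if and only if there are not two extra equations, and
no equation without unknowns at a contested endpoint. The solutions are partial sums up to a
constant `C`, which can be adapted to one extra equation. -/
theorem scalar_solvable_iff (hl : l < r) (hl' : l' < r') :
    (∀ φ : ℕ → K, ∃ H : ℕ → K,
      (∀ m, ¬(m ∈ Set.Icc (l + 1) r ∧ m ∈ Set.Icc (l' + 1) r') → H m = 0) ∧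
      ∀ m, ActiveNode ε l r l' r' m → H (m + 1) - H m = φ m) ↔
    (l < r' → l' < r → ¬(BelowLeft ε l l' ∧ AboveRight ε r r')) ∧
      (r = l' → ε r = Side.over) ∧ (r' = l → ε r' = Side.under) := by
  constructor
  · intro h
    refine ⟨?_, ?_, ?_⟩
    · rintro h₁ h₂ ⟨hB, hA⟩
      -- A right-hand side concentrated at the left end forces `H = 1` up to the right end.
      obtain ⟨H, hH, hact⟩ := h fun m => if m = max l l' then 1 else 0
      simp only [Set.mem_Icc] at hH
      have key : ∀ m, max l l' ≤ m → m ≤ min r r' → H (m + 1) = 1 := by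
        intro m hm
        induction m, hm using Nat.le_induction with
        | base =>
          intro _
          have := hact (max l l') ((activeNode_iff hl hl' h₁ h₂ _).2 (.inr (.inl ⟨rfl, hB⟩)))
          rwa [if_pos rfl, hH (max l l') (by omega), sub_zero] at this
        | succ m hm ih =>
          intro hm'
          have := hact (m + 1) ((activeNode_iff hl hl' h₁ h₂ _).2 (by
            rcases hm'.lt_or_eq with h1 | h1
            · exact .inl ⟨by omega, h1⟩
            · exact .inr (.inr ⟨h1, hA⟩)))
          rwa [if_neg (by omega), sub_eq_zero, ih (by omega)] at this
      have := key (min r r') (by omega) le_rfl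
      rw [hH _ (by omega)] at this
      exact zero_ne_one this
    · rintro rfl
      by_contra hε
      obtain ⟨H, hH, hact⟩ := h fun m => 1
      simp only [Set.mem_Icc] at hH
      have := hact r (.inr ⟨(Side.under_or_over _).resolve_right hε, ⟨hl, le_rfl⟩, ⟨le_rfl, hl'⟩⟩)
      rw [hH _ (by omega), hH _ (by omega), sub_zero] at this
      exact zero_ne_one this
    · rintro rfl
      by_contra hε
      obtain ⟨H, hH, hact⟩ := h fun m => 1
      simp only [Set.mem_Icc] at hH
      have := hact r' (.inl ⟨(Side.under_or_over _).resolve_left hε, ⟨le_rfl, hl⟩, ⟨hl', le_rfl⟩⟩)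
      rw [hH _ (by omega), hH _ (by omega), sub_zero] at this
      exact zero_ne_one this
  · rintro ⟨h, h3, h4⟩ φ
    by_cases hov : l < r' ∧ l' < r
    · obtain ⟨h₁, h₂⟩ := hov
      -- An extra equation at the left end says that the partial sum minus `C` is zero at
      -- `max l l'`, and one at the right end that it is zero at `min r r' + 1`.
      obtain ⟨C, hC₁, hC₂⟩ : ∃ C : K,
          (BelowLeft ε l l' → C = ∑ i ∈ Finset.range (max l l'), φ i) ∧
          (AboveRight ε r r' → C = ∑ i ∈ Finset.range (min r r' + 1), φ i) := by
        by_cases hB : BelowLeft ε l l'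
        · exact ⟨_, fun _ => rfl, fun hA => absurd ⟨hB, hA⟩ (h h₁ h₂)⟩
        · exact ⟨_, fun hB' => absurd hB' hB, fun _ => rfl⟩
      refine ⟨fun m => if max l l' < m ∧ m ≤ min r r' then ∑ i ∈ Finset.range m, φ i - C else 0,
        fun m hm => if_neg ?_, fun m hm => ?_⟩
      · simp only [Set.mem_Icc] at hm
        omega
      · rw [activeNode_iff hl hl' h₁ h₂] at hm
        dsimp only
        rcases hm with hm | ⟨rfl, hB⟩ | ⟨rfl, hA⟩
        · rw [if_pos (by omega), if_pos (by omega), Finset.sum_range_succ]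
          ring
        · rw [if_pos (by omega), if_neg (by omega), Finset.sum_range_succ, hC₁ hB]
          ring
        · rw [if_neg (by omega), if_pos (by omega), hC₂ hA, Finset.sum_range_succ]
          ring
    · refine ⟨0, fun m _ => rfl, fun m hm => ?_⟩
      exfalso
      simp only [ActiveNode, Set.mem_Icc] at hm
      rcases hm with ⟨hε, hm⟩ | ⟨hε, hm⟩
      · obtain rfl : r' = m := by omega
        rw [h4 (by omega)] at hε
        exact absurd hε (by simp)
      · obtain rfl : r = m := by omega
        rw [h3 (by omega)] at hε
        exact absurd hε (by simp)

end Scalars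

section

variable {K : Type u} [Field K] {n : ℕ} {ε : ℕ → Side}

/-- Extension by zero of a function on the vertices. -/
theorem exists_nat_extension (F : Vertex n ε → K) :
    ∃ H : ℕ → K, (∀ v : Vertex n ε, H v.idx = F v) ∧ ∀ m, m ∉ Set.Icc 1 n → H m = 0 := by
  refine ⟨fun m => if hm : 1 ≤ m ∧ m ≤ n then F ⟨m, hm.1, hm.2⟩ else 0, fun v => ?_, fun m hm => ?_⟩
  · exact dif_pos ⟨v.one_le, v.le_n⟩
  · exact dif_neg hm

theorem activeNode_of_arrow {l r l' r' : ℕ} {s t : Vertex n ε} (e : s ⟶ t)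
    (ht : t.idx ∈ Set.Icc (l + 1) r) (hs : s.idx ∈ Set.Icc (l' + 1) r') :
    (t.idx = s.idx + 1 ∧ ActiveNode ε l r l' r' s.idx) ∨
      (s.idx = t.idx + 1 ∧ ActiveNode ε l r l' r' t.idx) := by
  rcases arrow_idx e with ⟨h, hε⟩ | ⟨h, hε⟩
  · exact .inl ⟨h, .inl ⟨hε, h ▸ ht, hs⟩⟩
  · exact .inr ⟨h, .inr ⟨hε, ht, h ▸ hs⟩⟩

theorem exists_arrow_of_activeNode {l r l' r' m : ℕ} (hr : r ≤ n) (hr' : r' ≤ n)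
    (hm : ActiveNode ε l r l' r' m) : ∃ (s t : Vertex n ε) (_ : s ⟶ t),
      t.idx ∈ Set.Icc (l + 1) r ∧ s.idx ∈ Set.Icc (l' + 1) r' ∧
      ((t.idx = m + 1 ∧ s.idx = m) ∨ (s.idx = m + 1 ∧ t.idx = m)) := by
  rcases hm with ⟨hε, h1, h2⟩ | ⟨hε, h1, h2⟩
  · let s : Vertex n ε := ⟨m, by have := h2.1; omega, h2.2.trans hr'⟩
    let t : Vertex n ε := ⟨m + 1, by omega, h1.2.trans hr⟩
    exact ⟨s, t, Arrow.a s t rfl hε, h1, h2, .inl ⟨rfl, rfl⟩⟩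
  · let t : Vertex n ε := ⟨m, by have := h1.1; omega, h1.2.trans hr⟩
    let s : Vertex n ε := ⟨m + 1, by omega, h2.2.trans hr'⟩
    exact ⟨s, t, Arrow.aStar t s rfl hε, h1, h2, .inr ⟨rfl, rfl⟩⟩

/-- A function on the arrows as a function `ψ` of the smaller of the two vertices, with the sign
for which `H t - H s = φ e` reads `H (m + 1) - H m = ψ m` for both directions of the arrow. -/
theorem exists_edge_function (φ : ∀ ⦃s t : Vertex n ε⦄, (s ⟶ t) → K) :
    ∃ ψ : ℕ → K, ∀ ⦃s t : Vertex n ε⦄ (e : s ⟶ t),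
      (t.idx = s.idx + 1 → φ e = ψ s.idx) ∧ (s.idx = t.idx + 1 → φ e = -ψ t.idx) := by
  have h : ∀ m, ∃ c : K, ∀ ⦃s t : Vertex n ε⦄ (e : s ⟶ t),
      (t.idx = s.idx + 1 → s.idx = m → φ e = c) ∧ (s.idx = t.idx + 1 → t.idx = m → φ e = -c) := by
    intro m
    by_cases hm : ∃ (s t : Vertex n ε) (_ : s ⟶ t), min s.idx t.idx = m
    · obtain ⟨s, t, e, hm⟩ := hm
      refine ⟨if t.idx = s.idx + 1 then φ e else -φ e, fun s' t' e' => ?_⟩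
      have h1 := arrow_idx e
      have h2 := arrow_idx e'
      constructor
      · rintro h3 rfl
        obtain ⟨h4, -⟩ : t.idx = s.idx + 1 ∧ ε s.idx = Side.over := by
          refine h1.resolve_right fun h4 => ?_
          have h5 := (h2.resolve_right fun h => by omega).2
          rw [← hm, min_eq_right (by omega), h4.2] at h5
          exact absurd h5 (by simp)
        obtain rfl : s = s' := Vertex.ext (by omega)
        obtain rfl : t = t' := Vertex.ext (by omega)
        rw [if_pos h4, Subsingleton.elim e e']
      · rintro h3 rfl
        obtain ⟨h4, -⟩ : s.idx = t.idx + 1 ∧ ε t.idx = Side.under := by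
          refine h1.resolve_left fun h4 => ?_
          have h5 := (h2.resolve_left fun h => by omega).2
          rw [← hm, min_eq_left (by omega), h4.2] at h5
          exact absurd h5 (by simp)
        obtain rfl : s = s' := Vertex.ext (by omega)
        obtain rfl : t = t' := Vertex.ext (by omega)
        rw [if_neg (by omega), neg_neg, Subsingleton.elim e e']
    · refine ⟨0, fun s t e => ⟨fun h1 h2 => (hm ⟨s, t, e, by omega⟩).elim,
        fun h1 h2 => (hm ⟨s, t, e, by omega⟩).elim⟩⟩
  choose ψ hψ using h
  exact ⟨ψ, fun s t e => ⟨fun h => (hψ _ e).1 h rfl, fun h => (hψ _ e).2 h rfl⟩⟩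

variable {X Y : Rep K n ε} {l r l' r' : ℕ}

theorem IntervalBasis.hom_eq_zero_iff_belowLeft_or_aboveRight (B : IntervalBasis X (l + 1) r)
    (C : IntervalBasis Y (l' + 1) r') : (∀ f : X ⟶ Y, f = 0) ↔
      (l < r' → l' < r → BelowLeft ε l l' ∨ AboveRight ε r r') := by
  rw [B.hom_eq_zero_iff C, ← scalar_eq_zero_iff (K := K) B.le C.le]
  constructor
  · intro h H hH hact m
    by_cases hm : m ∈ Set.Icc 1 n
    · refine h (fun v => H v.idx) (fun v hv => hH _ hv) (fun s t e ht hs => ?_) ⟨m, hm.1, hm.2⟩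
      rcases activeNode_of_arrow e ht hs with ⟨h1, h2⟩ | ⟨h1, h2⟩
      · rw [h1]; exact hact _ h2
      · rw [h1]; exact (hact _ h2).symm
    · exact hH m fun h => hm ⟨by have := h.1.1; omega, h.1.2.trans B.le_n⟩
  · intro h F hF hact v
    obtain ⟨H, hH, hH0⟩ := exists_nat_extension F
    rw [← hH]
    refine h H (fun m hm => ?_) (fun m hm => ?_) _
    · by_cases hmn : m ∈ Set.Icc 1 n
      · exact (hH ⟨m, hmn.1, hmn.2⟩).trans (hF _ hm)
      · exact hH0 m hmn
    · obtain ⟨s, t, e, ht, hs, ⟨h1, h2⟩ | ⟨h1, h2⟩⟩ :=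
        exists_arrow_of_activeNode B.le_n C.le_n hm
      · rw [← h1, ← h2, hH, hH]; exact hact e ht hs
      · rw [← h1, ← h2, hH, hH]; exact (hact e ht hs).symm

theorem IntervalBasis.extOneVanishes_iff_not_belowLeft_and_aboveRight
    (B : IntervalBasis X (l + 1) r) (C : IntervalBasis Y (l' + 1) r') : ExtOneVanishes X Y ↔
      (l < r' → l' < r → ¬(BelowLeft ε l l' ∧ AboveRight ε r r')) ∧
      (r = l' → ε r = Side.over) ∧ (r' = l → ε r' = Side.under) := by
  rw [B.extOneVanishes_iff C, ← scalar_solvable_iff (K := K) B.le C.le]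
  constructor
  · intro h φ
    obtain ⟨F, hF, hact⟩ := h fun s t _ => if t.idx = s.idx + 1 then φ s.idx else -φ t.idx
    obtain ⟨H, hH, hH0⟩ := exists_nat_extension F
    refine ⟨H, fun m hm => ?_, fun m hm => ?_⟩
    · by_cases hmn : m ∈ Set.Icc 1 n
      · exact (hH ⟨m, hmn.1, hmn.2⟩).trans (hF _ hm)
      · exact hH0 m hmn
    · obtain ⟨s, t, e, ht, hs, ⟨h1, h2⟩ | ⟨h1, h2⟩⟩ :=
        exists_arrow_of_activeNode B.le_n C.le_n hm
      · have := hact e ht hs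
        rw [if_pos (by omega), ← hH, ← hH, h1, h2] at this
        exact this
      · have := hact e ht hs
        rw [if_neg (by omega), ← hH, ← hH, h1, h2] at this
        rw [← neg_sub, this, neg_neg]
  · intro h φ
    obtain ⟨ψ, hψ⟩ := exists_edge_function φ
    obtain ⟨H, hH, hact⟩ := h ψ
    refine ⟨fun v => H v.idx, fun v hv => hH _ hv, fun s t e ht hs => ?_⟩
    rcases activeNode_of_arrow e ht hs with ⟨h1, h2⟩ | ⟨h1, h2⟩
    · dsimp only
      rw [(hψ e).1 h1, ← hact _ h2, h1]
    · dsimp only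
      rw [(hψ e).2 h1, ← hact _ h2, h1, neg_sub]

end

end

/-! ### Crossings of arcs -/

section

variable {n : ℕ} {ε : ℕ → Side}

theorem BelowLeft.or_eq_or (ε : ℕ → Side) (l l' : ℕ) :
    BelowLeft ε l l' ∨ l = l' ∨ BelowLeft ε l' l := by
  unfold BelowLeft
  rcases (ε l).under_or_over with h | h <;> rcases (ε l').under_or_over with h' | h' <;>
    simp only [h, h'] <;> simp <;> omega

theorem AboveRight.or_eq_or (ε : ℕ → Side) (r r' : ℕ) :
    AboveRight ε r r' ∨ r = r' ∨ AboveRight ε r' r := by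
  unfold AboveRight
  rcases (ε r).under_or_over with h | h <;> rcases (ε r').under_or_over with h' | h' <;>
    simp only [h, h'] <;> simp <;> omega

theorem BelowLeft.ne {l l' : ℕ} (h : BelowLeft ε l l') : l ≠ l' := by
  rcases h with h | h <;> omega

theorem AboveRight.ne {r r' : ℕ} (h : AboveRight ε r r') : r ≠ r' := by
  rcases h with h | h <;> omega

/-- The piecewise linear interpolation of the values `v 0, …, v n`, written as a sum of hat
functions. -/
noncomputable def interp (n : ℕ) (v : ℕ → ℝ) (x : ℝ) : ℝ :=
  ∑ m ∈ Finset.range (n + 1), v m * max 0 (1 - |x - m|)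

theorem continuous_interp (n : ℕ) (v : ℕ → ℝ) : Continuous (interp n v) := by
  unfold interp
  fun_prop

theorem one_le_abs_sub_of_ne {i j : ℕ} (h : i ≠ j) : 1 ≤ |(i : ℝ) - j| := by
  have : (1 : ℤ) ≤ |(i : ℤ) - j| := Int.one_le_abs (by omega)
  exact_mod_cast this

theorem interp_natCast {j : ℕ} (v : ℕ → ℝ) (hj : j ≤ n) : interp n v j = v j := by
  unfold interp
  rw [Finset.sum_eq_single j]
  · simp
  · intro m _ hm
    rw [max_eq_left (by linarith [one_le_abs_sub_of_ne hm.symm]), mul_zero]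
  · intro h
    exact absurd (Finset.mem_range.2 (by omega)) h

/-- Interpolations are strictly ordered at `x` if the values are weakly ordered over the interval
and strictly ordered at a node at distance less than `1` from `x`. -/
theorem interp_lt_interp {v w : ℕ → ℝ} {A B : ℕ} (hB : B ≤ n) (hle : ∀ m, A ≤ m → m ≤ B → w m ≤ v m)
    {x : ℝ} (hx : x ∈ Set.Icc (A : ℝ) B) {m : ℕ} (hmB : m ≤ B) (hm : |x - m| < 1)
    (hlt : w m < v m) : interp n w x < interp n v x := by
  refine Finset.sum_lt_sum (fun i _ => ?_) ⟨m, Finset.mem_range.2 (by omega), ?_⟩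
  · by_cases hi : A ≤ i ∧ i ≤ B
    · exact mul_le_mul_of_nonneg_right (hle i hi.1 hi.2) (le_max_left _ _)
    · rw [max_eq_left, mul_zero, mul_zero]
      rw [sub_nonpos, le_abs]
      by_cases h : i < A
      · have : (i : ℝ) + 1 ≤ A := by exact_mod_cast h
        left; linarith [hx.1]
      · have : (B : ℝ) + 1 ≤ i := by exact_mod_cast (show B + 1 ≤ i by omega)
        right; linarith [hx.2]
  · exact mul_lt_mul_of_pos_right hlt (lt_max_of_lt_right (by linarith))

open Classical in
/-- Heights of an admissible arc at the nodes: `p` at the nodes it passes above, `-q` at the nodes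
it passes below, and `0` at the endpoints and outside. -/
noncomputable def ArcClass.height (ε : ℕ → Side) (γ : ArcClass n) (p q : ℝ) (m : ℕ) : ℝ :=
  if γ.left < m ∧ m < γ.right then (if ε m = Side.over then p else -q) else 0

namespace ArcClass

variable {γ γ' : ArcClass n}

/-- The combinatorial form of the conditions on a pair of terms: over a common interval exactly one
of `BelowLeft` and `AboveRight` holds, and contested endpoints have the prescribed type. The
conditions are grouped so that the first one describes the vanishing of `Hom` and the others that
of `Ext¹`. -/
def Compatible (ε : ℕ → Side) (γ γ' : ArcClass n) : Prop :=
  (γ.left < γ'.right → γ'.left < γ.right →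
    BelowLeft ε γ.left γ'.left ∨ AboveRight ε γ.right γ'.right) ∧
  (γ.left < γ'.right → γ'.left < γ.right →
    ¬(BelowLeft ε γ.left γ'.left ∧ AboveRight ε γ.right γ'.right)) ∧
  (γ.right = γ'.left → ε γ.right = Side.over) ∧
  (γ'.right = γ.left → ε γ'.right = Side.under)

theorem isRep_interp (hγ : γ.Admissible ε) {p q : ℝ} (hp : 0 < p) (hq : 0 < q) :
    γ.IsRep (interp n (γ.height ε p q)) where
  continuousOn := (continuous_interp _ _).continuousOn
  map_left := by
    rw [interp_natCast _ (γ.left_lt_right.le.trans γ.right_le), height, if_neg (by omega)]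
  map_right := by
    rw [interp_natCast _ γ.right_le, height, if_neg (by omega)]
  pos_of_mem m hm h := by
    have hm' := Finset.mem_Ioo.1 hm
    rwa [interp_natCast _ (hm'.2.le.trans γ.right_le), height, if_pos hm', if_pos ((hγ m hm).1 h)]
  neg_of_notMem m hm h := by
    have hm' := Finset.mem_Ioo.1 hm
    rw [interp_natCast _ (hm'.2.le.trans γ.right_le), height, if_pos hm',
      if_neg (mt (hγ m hm).2 h)]
    linarith

/-- If `γ` is weakly above `γ'` at both ends of the common interval, it has a representative which
is strictly above one of `γ'`, except at shared endpoints. The heights `2, -1` for `γ` and `1, -2`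
for `γ'` achieve this at all nodes that both arcs pass. -/
theorem exists_isRep_lt (hγ : γ.Admissible ε) (hγ' : γ'.Admissible ε) (h₁ : γ.left < γ'.right)
    (h₂ : γ'.left < γ.right) (hne : γ.left ≠ γ'.left ∨ γ.right ≠ γ'.right)
    (hL : γ.left = γ'.left ∨ BelowLeft ε γ'.left γ.left)
    (hR : γ.right = γ'.right ∨ AboveRight ε γ.right γ'.right) :
    ∃ f f' : ℝ → ℝ, γ.IsRep f ∧ γ'.IsRep f' ∧
      ∀ x ∈ Set.Icc (γ.left : ℝ) γ.right, x ∈ Set.Icc (γ'.left : ℝ) γ'.right →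
        f' x < f x ∨ ∃ m : ℕ, (m : ℝ) = x ∧ γ.SharedEndpoint γ' m := by
  have hlr := γ.left_lt_right
  have hlr' := γ'.left_lt_right
  have hrn := γ.right_le
  have hmain : ∀ m, max γ.left γ'.left ≤ m → m ≤ min γ.right γ'.right →
      γ'.height ε 1 2 m < γ.height ε 2 1 m ∨
        (γ'.height ε 1 2 m = γ.height ε 2 1 m ∧ γ.SharedEndpoint γ' m) := by
    intro m hA hB
    unfold height SharedEndpoint
    by_cases hm : γ.left < m ∧ m < γ.right <;> by_cases hm' : γ'.left < m ∧ m < γ'.right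
    · left
      rw [if_pos hm, if_pos hm']
      split_ifs <;> norm_num
    · left
      have hε : ε m = Side.over := by
        by_cases h : m = γ'.left
        · rcases hL.resolve_left (by omega) with h' | h'
          · omega
          · exact h ▸ h'.2
        · obtain rfl : m = γ'.right := by omega
          rcases hR.resolve_left (by omega) with h' | h'
          · exact h'.2
          · omega
      rw [if_pos hm, if_neg hm', if_pos hε]
      norm_num
    · left
      have hε : ε m = Side.under := by
        by_cases h : m = γ.left
        · rcases hL.resolve_left (by omega) with h' | h'
          · exact h ▸ h'.2
          · omega
        · obtain rfl : m = γ.right := by omega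
          rcases hR.resolve_left (by omega) with h' | h'
          · omega
          · exact h'.2
      rw [if_neg hm, if_pos hm', if_neg (by simp [hε])]
      norm_num
    · right
      rw [if_neg hm, if_neg hm']
      exact ⟨rfl, by omega⟩
  refine ⟨interp n (γ.height ε 2 1), interp n (γ'.height ε 1 2), isRep_interp hγ two_pos one_pos,
    isRep_interp hγ' one_pos two_pos, fun x hx hx' => ?_⟩
  by_contra! hno
  have hxI : x ∈ Set.Icc ((max γ.left γ'.left : ℕ) : ℝ) ((min γ.right γ'.right : ℕ) : ℝ) := by
    rw [Nat.cast_max, Nat.cast_min]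
    exact ⟨max_le hx.1 hx'.1, le_min hx.2 hx'.2⟩
  have hx0 : 0 ≤ x := (Nat.cast_nonneg _).trans hx.1
  have hshared : ∀ m, max γ.left γ'.left ≤ m → m ≤ min γ.right γ'.right → |x - m| < 1 →
      γ.SharedEndpoint γ' m := by
    intro m hA hB hm
    rcases hmain m hA hB with h | h
    · refine absurd (interp_lt_interp (by omega) (fun i hi hi' => ?_) hxI hB hm h) hno.1.not_gt
      rcases hmain i hi hi' with h | h
      exacts [h.le, h.1.le]
    · exact h.2
  have hk := Nat.floor_le hx0
  have hk' := Nat.lt_floor_add_one x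
  -- If the order were not strict, both `k` and, for `x` not a node, `k + 1` would be shared
  -- endpoints, and the arcs would have the same endpoints.
  set k := ⌊x⌋₊
  have hkA : max γ.left γ'.left ≤ k := Nat.le_floor hxI.1
  have hkB : k ≤ min γ.right γ'.right := by exact_mod_cast hk.trans hxI.2
  have h1 := hshared k hkA hkB (by rw [abs_lt]; constructor <;> linarith)
  rcases hk.lt_or_eq with hlt | heq
  · have hkB' : k < min γ.right γ'.right := by exact_mod_cast hlt.trans_le hxI.2
    have h2 := hshared (k + 1) (by omega) (by omega) (by
      push_cast; rw [abs_lt]; constructor <;> linarith)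
    unfold SharedEndpoint at h1 h2
    omega
  · exact hno.2 k heq h1

/-- By the intermediate value theorem, uncrossed representatives do not change order: a meeting
point strictly between two points of the common interval is not an endpoint of either arc. -/
theorem Uncrossed.not_lt_and_lt {f g : ℝ → ℝ} (h : γ.Uncrossed γ' f g) {x y : ℝ}
    (hx : x ∈ Set.Icc (γ.left : ℝ) γ.right) (hx' : x ∈ Set.Icc (γ'.left : ℝ) γ'.right)
    (hy : y ∈ Set.Icc (γ.left : ℝ) γ.right) (hy' : y ∈ Set.Icc (γ'.left : ℝ) γ'.right)
    (hfx : f x < g x) (hfy : g y < f y) : False := by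
  have hsub := Set.uIcc_subset_Icc hx hy
  have hsub' := Set.uIcc_subset_Icc hx' hy'
  have hc : ContinuousOn (fun z => f z - g z) (Set.uIcc x y) :=
    (h.rep₁.continuousOn.mono hsub).sub (h.rep₂.continuousOn.mono hsub')
  obtain ⟨z, hz, hz0⟩ := intermediate_value_uIcc hc
    (show (0 : ℝ) ∈ Set.uIcc _ _ from Set.mem_uIcc.2 (.inl ⟨by linarith, by linarith⟩))
  have hzx : z ≠ x := by rintro rfl; simp only at hz0; linarith
  have hzy : z ≠ y := by rintro rfl; simp only at hz0; linarith
  have hz1 : (γ.left : ℝ) < z ∧ z < γ.right ∧ (γ'.left : ℝ) < z ∧ z < γ'.right := by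
    rcases Set.mem_uIcc.1 hz with h1 | h1
    · have h2 := lt_of_le_of_ne h1.1 hzx.symm
      have h3 := lt_of_le_of_ne h1.2 hzy
      exact ⟨by linarith [hx.1], by linarith [hy.2], by linarith [hx'.1], by linarith [hy'.2]⟩
    · have h2 := lt_of_le_of_ne h1.1 hzy.symm
      have h3 := lt_of_le_of_ne h1.2 hzx
      exact ⟨by linarith [hy.1], by linarith [hx.2], by linarith [hy'.1], by linarith [hx'.2]⟩
  obtain ⟨m, rfl, hm⟩ := h.meet z (hsub hz) (hsub' hz) (sub_eq_zero.1 hz0)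
  norm_cast at hz1
  unfold SharedEndpoint ContestedEndpoint at hm
  omega

theorem IsRep.pos (hγ : γ.Admissible ε) {f : ℝ → ℝ} (h : γ.IsRep f) {m : ℕ} (h1 : γ.left < m)
    (h2 : m < γ.right) (hm : ε m = Side.over) : 0 < f m :=
  h.pos_of_mem m (Finset.mem_Ioo.2 ⟨h1, h2⟩) ((hγ m (Finset.mem_Ioo.2 ⟨h1, h2⟩)).2 hm)

theorem IsRep.neg (hγ : γ.Admissible ε) {f : ℝ → ℝ} (h : γ.IsRep f) {m : ℕ} (h1 : γ.left < m)
    (h2 : m < γ.right) (hm : ε m = Side.under) : f m < 0 :=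
  h.neg_of_notMem m (Finset.mem_Ioo.2 ⟨h1, h2⟩) fun h3 => by
    rw [hγ m (Finset.mem_Ioo.2 ⟨h1, h2⟩), hm] at h3
    exact absurd h3 (by simp)

theorem IsRep.lt_of_belowLeft (hγ : γ.Admissible ε) (hγ' : γ'.Admissible ε) {f g : ℝ → ℝ}
    (hf : γ.IsRep f) (hg : γ'.IsRep g) (h₁ : γ.left < γ'.right) (h₂ : γ'.left < γ.right)
    (h : BelowLeft ε γ.left γ'.left) :
    f (max γ.left γ'.left : ℕ) < g (max γ.left γ'.left : ℕ) := by
  rcases h with ⟨h, hε⟩ | ⟨h, hε⟩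
  · rw [max_eq_right h.le, hg.map_left]
    exact hf.neg hγ h h₂ hε
  · rw [max_eq_left h.le, hf.map_left]
    exact hg.pos hγ' h h₁ hε

theorem IsRep.lt_of_aboveRight (hγ : γ.Admissible ε) (hγ' : γ'.Admissible ε) {f g : ℝ → ℝ}
    (hf : γ.IsRep f) (hg : γ'.IsRep g) (h₁ : γ.left < γ'.right) (h₂ : γ'.left < γ.right)
    (h : AboveRight ε γ.right γ'.right) :
    g (min γ.right γ'.right : ℕ) < f (min γ.right γ'.right : ℕ) := by
  rcases h with ⟨h, hε⟩ | ⟨h, hε⟩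
  · rw [min_eq_right h.le, hg.map_right]
    exact hf.pos hγ h₁ h hε
  · rw [min_eq_left h.le, hf.map_right]
    exact hg.neg hγ' h₂ h hε

/-- Two admissible arcs satisfy the conditions on a pair of terms of a strand diagram if and only if
they are compatible. -/
theorem uncrossed_and_clockwise_iff (hγ : γ.Admissible ε) (hγ' : γ'.Admissible ε) :
    ((∃ f g : ℝ → ℝ, γ.Uncrossed γ' f g) ∧
      ((∃ x, γ.SharedEndpoint γ' x) → γ'.Clockwise γ) ∧
      (∀ x, γ.ContestedEndpoint γ' x →
        (ε x = Side.over → x = γ.right) ∧ (ε x = Side.under → x = γ'.right))) ↔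
    γ.Compatible ε γ' := by
  have hlr := γ.left_lt_right
  have hlr' := γ'.left_lt_right
  have hR : (γ.left : ℝ) + 1 ≤ γ.right := by exact_mod_cast hlr
  have hR' : (γ'.left : ℝ) + 1 ≤ γ'.right := by exact_mod_cast hlr'
  have hmax (h₁ : γ.left < γ'.right) (h₂ : γ'.left < γ.right) :
      ((max γ.left γ'.left : ℕ) : ℝ) ∈ Set.Icc (γ.left : ℝ) γ.right ∧
        ((max γ.left γ'.left : ℕ) : ℝ) ∈ Set.Icc (γ'.left : ℝ) γ'.right := by
    simp only [Set.mem_Icc, Nat.cast_le]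
    omega
  have hmin (h₁ : γ.left < γ'.right) (h₂ : γ'.left < γ.right) :
      ((min γ.right γ'.right : ℕ) : ℝ) ∈ Set.Icc (γ.left : ℝ) γ.right ∧
        ((min γ.right γ'.right : ℕ) : ℝ) ∈ Set.Icc (γ'.left : ℝ) γ'.right := by
    simp only [Set.mem_Icc, Nat.cast_le]
    omega
  constructor
  · rintro ⟨hU, hS, hC⟩
    refine ⟨fun h₁ h₂ => ?_, fun h₁ h₂ => ?_, fun h => ?_, fun h => ?_⟩
    · by_contra! hno
      -- Without `BelowLeft` and `AboveRight`, the first arc is above the second one close to the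
      -- left end of the common interval and below it close to the right end; at shared endpoints
      -- this is the clockwise condition.
      obtain ⟨f, g, hfg, hcl, hcr⟩ : ∃ f g : ℝ → ℝ, γ.Uncrossed γ' f g ∧
          (γ.left = γ'.left → ∀ η : ℝ, 0 < η → ∃ δ : ℝ, 0 < δ ∧ δ < η ∧
            g (γ.left + δ) < f (γ.left + δ)) ∧
          (γ.right = γ'.right → ∀ η : ℝ, 0 < η → ∃ δ : ℝ, 0 < δ ∧ δ < η ∧
            f (γ.right - δ) < g (γ.right - δ)) := by
        by_cases hs : ∃ x, γ.SharedEndpoint γ' x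
        · exact hS hs
        · obtain ⟨f, g, hfg⟩ := hU
          exact ⟨f, g, hfg, fun h => (hs ⟨_, .inl ⟨rfl, h.symm⟩⟩).elim,
            fun h => (hs ⟨_, .inr ⟨rfl, h.symm⟩⟩).elim⟩
      obtain ⟨y, hy, hy', hlt⟩ : ∃ y : ℝ, y ∈ Set.Icc (γ.left : ℝ) γ.right ∧
          y ∈ Set.Icc (γ'.left : ℝ) γ'.right ∧ g y < f y := by
        rcases (BelowLeft.or_eq_or ε γ.left γ'.left).resolve_left hno.1 with h | h
        · obtain ⟨δ, hδ, hδ', hlt⟩ := hcl h 1 one_pos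
          refine ⟨_, ⟨by linarith, by linarith⟩, ?_, hlt⟩
          rw [h]
          exact ⟨by linarith, by linarith⟩
        · have := hfg.rep₂.lt_of_belowLeft hγ' hγ hfg.rep₁ h₂ h₁ h
          rw [max_comm] at this
          exact ⟨_, (hmax h₁ h₂).1, (hmax h₁ h₂).2, this⟩
      obtain ⟨x, hx, hx', hlt'⟩ : ∃ x : ℝ, x ∈ Set.Icc (γ.left : ℝ) γ.right ∧
          x ∈ Set.Icc (γ'.left : ℝ) γ'.right ∧ f x < g x := by
        rcases (AboveRight.or_eq_or ε γ.right γ'.right).resolve_left hno.2 with h | h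
        · obtain ⟨δ, hδ, hδ', hlt⟩ := hcr h 1 one_pos
          refine ⟨_, ⟨by linarith, by linarith⟩, ?_, hlt⟩
          rw [h]
          exact ⟨by linarith, by linarith⟩
        · have := hfg.rep₂.lt_of_aboveRight hγ' hγ hfg.rep₁ h₂ h₁ h
          rw [min_comm] at this
          exact ⟨_, (hmin h₁ h₂).1, (hmin h₁ h₂).2, this⟩
      exact hfg.not_lt_and_lt hx hx' hy hy' hlt' hlt
    · rintro ⟨hB, hA⟩
      obtain ⟨f, g, hfg⟩ := hU
      exact hfg.not_lt_and_lt (hmax h₁ h₂).1 (hmax h₁ h₂).2 (hmin h₁ h₂).1 (hmin h₁ h₂).2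
        (hfg.rep₁.lt_of_belowLeft hγ hγ' hfg.rep₂ h₁ h₂ hB)
        (hfg.rep₁.lt_of_aboveRight hγ hγ' hfg.rep₂ h₁ h₂ hA)
    · refine (Side.under_or_over _).resolve_left fun hε => ?_
      have := (hC γ.right (.inl ⟨rfl, h.symm⟩)).2 hε
      omega
    · refine (Side.under_or_over _).resolve_right fun hε => ?_
      have := (hC γ'.right (.inr ⟨h.symm, rfl⟩)).1 hε
      omega
  · rintro ⟨h1, h2, h3, h4⟩
    by_cases hov : γ.left < γ'.right ∧ γ'.left < γ.right
    · obtain ⟨h₁, h₂⟩ := hov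
      have hC (x) (hx : γ.ContestedEndpoint γ' x) : False := by
        unfold ContestedEndpoint at hx
        omega
      rw [← and_assoc]
      refine ⟨?_, fun x hx => (hC x hx).elim⟩
      rcases h1 h₁ h₂ with hB | hA
      -- In the first case `γ'` is above `γ`, in the second case `γ` is above `γ'`. A shared
      -- endpoint can only be at the other end, where the order is the clockwise one.
      · obtain ⟨g, f, hg, hf, hlt⟩ := exists_isRep_lt hγ' hγ h₂ h₁ (.inl hB.ne.symm) (.inr hB)
          (((AboveRight.or_eq_or ε γ.right γ'.right).resolve_left
            fun hA => h2 h₁ h₂ ⟨hB, hA⟩).imp_left Eq.symm)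
        have hU : γ.Uncrossed γ' f g := ⟨hf, hg, fun x hx hx' h => by
          rcases hlt x hx' hx with h' | ⟨m, hm, h'⟩
          · exact (h'.ne h).elim
          · exact ⟨m, hm, .inl (h'.imp And.symm And.symm)⟩⟩
        refine ⟨⟨f, g, hU⟩, fun _ => ⟨f, g, hU, fun h => (hB.ne h).elim, fun h η hη => ?_⟩⟩
        obtain ⟨δ, hδ, hδη, hδ1⟩ : ∃ δ : ℝ, 0 < δ ∧ δ < η ∧ δ < 1 :=
          (exists_between (lt_min hη one_pos)).imp fun δ h => ⟨h.1, lt_min_iff.1 h.2⟩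
        have hr : (γ.right : ℝ) = γ'.right := by rw [h]
        refine ⟨δ, hδ, hδη, (hlt _ ⟨by linarith, by linarith⟩
          ⟨by linarith, by linarith⟩).resolve_right ?_⟩
        rintro ⟨m, hm, -⟩
        have h5 : m < γ.right := by
          have : (m : ℝ) < γ.right := by linarith
          exact_mod_cast this
        have h6 : γ.right < m + 1 := by
          have : (γ.right : ℝ) < m + 1 := by linarith
          exact_mod_cast this
        omega
      · obtain ⟨f, g, hf, hg, hlt⟩ := exists_isRep_lt hγ hγ' h₁ h₂ (.inr hA.ne)
          ((BelowLeft.or_eq_or ε γ.left γ'.left).resolve_left fun hB => h2 h₁ h₂ ⟨hB, hA⟩) (.inr hA)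
        have hU : γ.Uncrossed γ' f g := ⟨hf, hg, fun x hx hx' h => by
          rcases hlt x hx hx' with h' | ⟨m, hm, h'⟩
          · exact (h'.ne h.symm).elim
          · exact ⟨m, hm, .inl h'⟩⟩
        refine ⟨⟨f, g, hU⟩, fun _ => ⟨f, g, hU, fun h η hη => ?_, fun h => (hA.ne h).elim⟩⟩
        obtain ⟨δ, hδ, hδη, hδ1⟩ : ∃ δ : ℝ, 0 < δ ∧ δ < η ∧ δ < 1 :=
          (exists_between (lt_min hη one_pos)).imp fun δ h => ⟨h.1, lt_min_iff.1 h.2⟩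
        have hl : (γ.left : ℝ) = γ'.left := by rw [h]
        refine ⟨δ, hδ, hδη, (hlt _ ⟨by linarith, by linarith⟩
          ⟨by linarith, by linarith⟩).resolve_right ?_⟩
        rintro ⟨m, hm, -⟩
        have h5 : γ.left < m := by
          have : (γ.left : ℝ) < m := by linarith
          exact_mod_cast this
        have h6 : m < γ.left + 1 := by
          have : (m : ℝ) < γ.left + 1 := by linarith
          exact_mod_cast this
        omega
    · refine ⟨⟨_, _, isRep_interp hγ one_pos one_pos, isRep_interp hγ' one_pos one_pos,
        fun x hx hx' _ => ?_⟩, ?_, ?_⟩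
      · by_cases h : γ.left < γ'.right
        · have h5 : (γ.right : ℝ) ≤ γ'.left := by exact_mod_cast (by omega)
          exact ⟨γ.right, le_antisymm (h5.trans hx'.1) hx.2, .inr (.inl ⟨rfl, by
            have : (γ'.left : ℝ) ≤ γ.right := hx'.1.trans hx.2
            have : γ'.left ≤ γ.right := by exact_mod_cast this
            omega⟩)⟩
        · have h5 : (γ'.right : ℝ) ≤ γ.left := by exact_mod_cast (by omega)
          exact ⟨γ.left, le_antisymm hx.1 (hx'.2.trans h5), .inr (.inr ⟨rfl, by
            have : (γ.left : ℝ) ≤ γ'.right := hx.1.trans hx'.2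
            have : γ.left ≤ γ'.right := by exact_mod_cast this
            omega⟩)⟩
      · rintro ⟨x, hx⟩
        unfold SharedEndpoint at hx
        omega
      · rintro x (⟨rfl, h⟩ | ⟨rfl, h⟩)
        · exact ⟨fun _ => rfl, fun hε => by rw [h3 h.symm] at hε; exact absurd hε (by simp)⟩
        · refine ⟨fun hε => ?_, fun _ => h.symm⟩
          rw [← h, h4 h] at hε
          exact absurd hε (by simp)

end ArcClass

end

/-! ### The bijection -/

section

variable {K : Type u} [Field K] {n : ℕ} {ε : ℕ → Side}

theorem mem_strandDiagrams_iff {k : ℕ} {γ : Fin k → ArcClass n} : γ ∈ strandDiagrams n ε k ↔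
    (∀ i, (γ i).Admissible ε) ∧ ∀ i j, i < j → (γ i).Compatible ε (γ j) :=
  and_congr_right fun h => forall₃_congr fun i j _ =>
    ArcClass.uncrossed_and_clockwise_iff (h i) (h j)

/-- An admissible arc is determined by its endpoints. -/
theorem ArcClass.Admissible.eq {γ γ' : ArcClass n} (h : γ.Admissible ε) (h' : γ'.Admissible ε)
    (hl : γ.left = γ'.left) (hr : γ.right = γ'.right) : γ = γ' := by
  refine ArcClass.ext hl hr (Finset.ext fun m => ?_)
  by_cases hm : m ∈ Finset.Ioo γ.left γ.right
  · rw [h m hm, h' m (hl ▸ hr ▸ hm)]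
  · exact iff_of_false (fun h1 => hm (γ.above_subset h1))
      fun h1 => hm (hl ▸ hr ▸ γ'.above_subset h1)

theorem exists_intervalBasis_arcOfBrick (X : BrickRep K n ε) :
    Nonempty (IntervalBasis X.1 ((arcOfBrick X).left + 1) (arcOfBrick X).right) := by
  obtain ⟨a, b, ⟨B⟩⟩ := X.2.exists_intervalBasis
  rw [B.left_arcOfBrick X.2, B.right_arcOfBrick X.2, Nat.sub_add_cancel B.one_le]
  exact ⟨B⟩

theorem admissible_arcOfBrick (X : BrickRep K n ε) : (arcOfBrick X).Admissible ε := by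
  obtain ⟨B⟩ := exists_intervalBasis_arcOfBrick X
  exact B.admissible_arcOfBrick X.2

theorem compatible_arcOfBrick_iff (X Y : BrickRep K n ε) :
    (arcOfBrick X).Compatible ε (arcOfBrick Y) ↔
      (∀ f : X.1 ⟶ Y.1, f = 0) ∧ ExtOneVanishes X.1 Y.1 := by
  obtain ⟨B⟩ := exists_intervalBasis_arcOfBrick X
  obtain ⟨C⟩ := exists_intervalBasis_arcOfBrick Y
  exact and_congr (B.hom_eq_zero_iff_belowLeft_or_aboveRight C).symm
    (B.extOneVanishes_iff_not_belowLeft_and_aboveRight C).symm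

theorem extOneVanishes_self (X : BrickRep K n ε) : ExtOneVanishes X.1 X.1 := by
  obtain ⟨B⟩ := exists_intervalBasis_arcOfBrick X
  have := (arcOfBrick X).left_lt_right
  exact (B.extOneVanishes_iff_not_belowLeft_and_aboveRight B).2
    ⟨fun _ _ h => h.1.ne rfl, fun h => by omega, fun h => by omega⟩

theorem sigma_injective : Function.Injective (sigma : Brick K n ε → ArcClass n) := by
  intro x y
  induction x, y using Quotient.inductionOn₂ with
  | h X Y =>
    intro h
    obtain ⟨B⟩ := exists_intervalBasis_arcOfBrick X
    obtain ⟨C⟩ := exists_intervalBasis_arcOfBrick Y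
    rw [show arcOfBrick X = arcOfBrick Y from h] at B
    exact Quotient.sound (B.nonempty_iso C)

theorem exists_arcOfBrick_eq (K : Type u) [Field K] {γ : ArcClass n} (hγ : γ.Admissible ε) :
    ∃ X : BrickRep K n ε, arcOfBrick X = γ := by
  obtain ⟨X, ⟨B⟩⟩ := exists_intervalBasis K ε (Nat.le_add_left 1 γ.left) γ.left_lt_right γ.right_le
  exact ⟨⟨X, B.isBrick⟩, (B.admissible_arcOfBrick B.isBrick).eq hγ (B.left_arcOfBrick _)
    (B.right_arcOfBrick _)⟩

end

end StrandModel

/-- For every orientation `ε` of type `A_n` and every field `K`, the map `σ`, applied termwise, is a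
bijection from `weak(KA_n^ε, k)` to `arc_ε(n, k)`. -/
theorem theorem7p3 (K : Type u) [Field K] (n : ℕ) (ε : ℕ → StrandModel.Side) (k : ℕ) :
    Set.BijOn (fun (Δ : Fin k → StrandModel.Brick K n ε) (i : Fin k) => StrandModel.sigma (Δ i))
      (StrandModel.weakExceptional K n ε k) (StrandModel.strandDiagrams n ε k) := by
  refine ⟨?_, ?_, ?_⟩
  · rintro Δ ⟨X, hX, hw⟩
    rw [StrandModel.mem_strandDiagrams_iff]
    obtain rfl : (fun i => Quotient.mk _ (X i)) = Δ := funext hX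
    refine ⟨fun i => StrandModel.admissible_arcOfBrick (X i), fun i j hij => ?_⟩
    exact (StrandModel.compatible_arcOfBrick_iff (X i) (X j)).2
      ⟨hw.hom_eq_zero i j hij, hw.ext_eq_zero i j hij.le⟩
  · rintro Δ - Δ' - h
    exact funext fun i => StrandModel.sigma_injective (congrFun h i)
  · intro γ hγ
    rw [StrandModel.mem_strandDiagrams_iff] at hγ
    choose X hX using fun i => StrandModel.exists_arcOfBrick_eq K (hγ.1 i)
    refine ⟨fun i => Quotient.mk _ (X i), ⟨X, fun _ => rfl, ?_⟩, funext hX⟩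
    have h (i j) (hij : i < j) := (StrandModel.compatible_arcOfBrick_iff (X i) (X j)).1 (by
      rw [hX, hX]; exact hγ.2 i j hij)
    refine ⟨fun i => (X i).2.finite, fun i => ?_, fun i j hij => (h i j hij).1, fun i j hij => ?_⟩
    · obtain ⟨a, b, ⟨B⟩⟩ := (X i).2.exists_intervalBasis
      exact B.nonempty_end_algEquiv
    · rcases hij.lt_or_eq with hij | rfl
      · exact (h i j hij).2
      · exact StrandModel.extOneVanishes_self (X i)
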